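/- **Setting.** A symmetric Markov chain on $[n]=\{1,\dots,n\}$ ($n\ge 1$) is given by a symmetric stochastic matrix. For such chains $P,Q$ let $\sqrt{P\circ Q}=[\sqrt{P_{ij}Q_{ij}}]_{i,j\in[n]}$ and let $\rho$ denote the spectral radius. The hitting time of $Q$ is $h(Q)=\max_{r,s\in[n]}\mathbf E\left[\min\{t\ge 0: s_t=r\}\mid s_0=s\right]$. A trajectory of length $m$ of $P$ is a word $s_1\cdots s_m$ of consecutive states of the chain, where $s_1$ has an arbitrary (unknown) distribution. Let $H^2(p,q)=\frac12\sum_x(\sqrt{p_x}-\sqrt{q_x})^2$. **Identity testers.** An i.i.d. identity tester is a (randomized) procedure $T$ that receives $\varepsilon$, the description of a distribution $q$ on a finite set and a multiset of samples, and accepts or rejects. For $C_0>0$ call $T$ a $C_0$-Hellinger tester if for every finite set of size $N$, all distributions $p,q$ on it, all $\varepsilon\in(0,1]$ and all $k\ge C_0\sqrt N/\varepsilon$ the following holds on $k$ i.i.d. samples from $p$: if $p=q$, then $T$ accepts with probability at least $4/5$; if $H^2(p,q)\ge\varepsilon$, then $T$ rejects with probability at least $4/5$. **Independent Edges Sampler**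 with tester $T$ and constant $\theta>0$. Input: $\varepsilon\in(0,1]$, a symmetric chain $Q$ on $[n]$, and a trajectory $s_1\cdots s_m$ of a symmetric chain $P$. Let $(k_1,\dots,k_n)$ be the histogram of $\lfloor\theta m/\log^2(2n/\varepsilon)\rfloor$ i.i.d. uniform samples from $[n]$, drawn independently of the trajectory. For $t=1,\dots,m-1$: if fewer than $k_{s_t}$ transitions from the state $s_t$ have been recorded so far, record the transition $s_t\to s_{t+1}$. If for some $i$ fewer than $k_i$ transitions from $i$ have been recorded at the end, reject. Otherwise run $T$ with parameter $\varepsilon$ and the distribution $\{q_{ij}=\frac1nQ_{ij}\}_{i,j\in[n]}$ on the multiset of all recorded transitions $(i,j)$ and return its verdict. **Theorem.** (a) There are a constant $C_0>0$ and a $C_0$-Hellinger tester. (b) For every $C_0>0$ there are $\theta>0$, $C>0$ and $c\in\mathbb N$ such that the following holds for every $C_0$-Hellinger tester $T$, every $n\ge1$, every $\varepsilon\in(0,1]$, every symmetric Markov chain $Q$ on $[n]$ with $h(Q)<\infty$, and every $$m\ \ge\ C\,\log^{c}\!\Big(\frac{2n}{\varepsilon}\Big)\cdot\Big(h(Q)\log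 h(Q)+\frac n\varepsilon\Big)$$ (where $0\log 0=0$). For every symmetric Markov chain $P$ on $[n]$ and every initial distribution, the Independent Edges Sampler with tester $T$ and constant $\theta$, run on a single trajectory of length $m$ of $P$, * accepts with probability at least $2/3$ if $P=Q$; * rejects with probability at least $2/3$ if $1-\rho(\sqrt{P\circ Q})>\varepsilon$. -/

import Mathlib

open scoped ENNReal

namespace MarkovTesting

noncomputable section

/-- A Markov chain on the state space `[n]`, given by its transition matrix: row `i` is the
distribution of the next state when the present state is `i`. -/
abbrev Chain (n : ℕ) := Fin n → PMF (Fin n)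

/-- The chain is symmetric: its transition matrix is a symmetric matrix. -/
def Chain.Symmetric {n : ℕ} (P : Chain n) : Prop := ∀ i j, P i j = P j i

/-- The matrix with entries `√(P i j * Q i j)`. -/
def sqrtProd {n : ℕ} (P Q : Chain n) : Matrix (Fin n) (Fin n) ℝ :=
  Matrix.of fun i j => √((P i j).toReal * (Q i j).toReal)

/-- The spectral radius of a real square matrix: the largest modulus of a complex eigenvalue. -/
def specRadius {n : ℕ} (A : Matrix (Fin n) (Fin n) ℝ) : ℝ :=
  (spectralRadius ℂ (A.map Complex.ofReal)).toReal

/-- The law of the list of states `[s₀, …, s_t]` of the chain that starts at `s₀ = s` and makes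
`t` steps. -/
def walk {n : ℕ} (P : Chain n) : ℕ → Fin n → PMF (List (Fin n))
  | 0, s => PMF.pure [s]
  | t + 1, s => (P s).bind fun s' => (walk P t s').map (List.cons s)

/-- The law of a trajectory of length `m`, that is, of `m` consecutive states `[s₁, …, s_m]`, of
the chain `P` with initial distribution `μ`. -/
def trajectory {n : ℕ} (P : Chain n) (μ : PMF (Fin n)) : ℕ → PMF (List (Fin n))
  | 0 => PMF.pure []
  | t + 1 => μ.bind (walk P t)

/-- The probability that the chain started at `s` visits `r` for the first time at time `t`:
the first occurrence of `r` in `[s₀, …, s_t]` has index `t`. -/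
def firstVisitProb {n : ℕ} (P : Chain n) (s r : Fin n) (t : ℕ) : ℝ≥0∞ :=
  (walk P t s).toOuterMeasure {w | w.idxOf r = t}

/-- The expectation of `min {t ≥ 0 : s_t = r}` given `s₀ = s`. The minimum is `∞` when `r` is
never visited, which has the probability `1 - ∑' t, firstVisitProb P s r t`. -/
def expectedVisitTime {n : ℕ} (P : Chain n) (s r : Fin n) : ℝ≥0∞ :=
  (∑' t : ℕ, (t : ℝ≥0∞) * firstVisitProb P s r t) +
    ∞ * (1 - ∑' t : ℕ, firstVisitProb P s r t)

/-- The hitting time of the chain: the largest expected time to visit a state, over all pairs of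
a target `r` and a starting state `s`. -/
def hittingTime {n : ℕ} (P : Chain n) : ℝ≥0∞ :=
  ⨆ (r : Fin n) (s : Fin n), expectedVisitTime P s r

/-- The squared Hellinger distance of two distributions on a finite set. -/
def hellingerSq {α : Type} [Fintype α] (p q : PMF α) : ℝ :=
  1 / 2 * ∑ x, (√(p x).toReal - √(q x).toReal) ^ 2

/-- The law of the multiset of `k` independent samples from `p`. -/
def iidSamples {α : Type} (p : PMF α) : ℕ → PMF (Multiset α)
  | 0 => PMF.pure 0
  | k + 1 => p.bind fun x => (iidSamples p k).map (Multiset.cons x)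

/-- A (randomized) identity tester: from a distance parameter `ε`, the description of a
distribution `q` and a multiset of samples it computes, possibly with additional coin tosses,
a verdict, `true` for accept and `false` for reject. -/
abbrev IdentityTester := (α : Type) → ℝ → PMF α → Multiset α → PMF Bool

/-- From at least `C * √N / ε` independent samples of an unknown distribution `p` on a set of `N`
elements, the tester tells `p = q` from `H²(p, q) ≥ ε` with probability at least `4/5`. -/
def IdentityTester.IsHellingerTester (T : IdentityTester) (C : ℝ) : Prop :=
  ∀ (α : Type) [Fintype α] (ε : ℝ), 0 < ε → ε ≤ 1 → ∀ (q : PMF α) (k : ℕ),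
    C * √(Fintype.card α) / ε ≤ k → ∀ p : PMF α,
      (p = q → 4 / 5 ≤ ((iidSamples p k).bind (T α ε q)) true) ∧
      (ε ≤ hellingerSq p q → 4 / 5 ≤ ((iidSamples p k).bind (T α ε q)) false)

/-- The distribution `q (i, j) = Q i j / n` on `[n] × [n]`. -/
def edgeDist {n : ℕ} [NeZero n] (Q : Chain n) : PMF (Fin n × Fin n) :=
  (PMF.uniformOfFintype (Fin n)).bind fun i => (Q i).map (Prod.mk i)

/-- One round of the sampling loop: the transition `e` is added to the samples of its first state
unless that state already has its full number of samples. -/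
def addEdge {n : ℕ} (k : Fin n → ℕ) (S : Fin n → Multiset (Fin n × Fin n))
    (e : Fin n × Fin n) : Fin n → Multiset (Fin n × Fin n) :=
  if (S e.1).card < k e.1 then Function.update S e.1 (e ::ₘ S e.1) else S

/-- The sampling loop, over the transitions `(s₁, s₂), …, (s_{m-1}, s_m)` of the word `w`. -/
def collect {n : ℕ} (k : Fin n → ℕ) (w : List (Fin n)) : Fin n → Multiset (Fin n × Fin n) :=
  (w.zip w.tail).foldl (addEdge k) fun _ => 0

/-- The Independent Edges Sampler with the black-box tester `T`, on the input `ε`, `Q` and the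
observed trajectory `w`. The numbers of samples `k i` form the histogram of
`⌊θ * m / log² (2 n / ε)⌋` independent uniform samples from `[n]`, where `m` is the length of `w`;
the trajectory is rejected when it does not yield `k i` transitions from some state `i`, and
otherwise the collected transitions are passed to `T`. -/
def independentEdgesSampler (T : IdentityTester) (θ : ℝ) {n : ℕ} [NeZero n] (ε : ℝ)
    (Q : Chain n) (w : List (Fin n)) : PMF Bool :=
  (iidSamples (PMF.uniformOfFintype (Fin n))
      ⌊θ * w.length / Real.log (2 * n / ε) ^ 2⌋₊).bind fun h =>
    let S := collect (fun i => h.count i) w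
    if ∃ i, (S i).card < h.count i then PMF.pure false
    else T (Fin n × Fin n) ε (edgeDist Q) (∑ i, S i)

end

end MarkovTesting

open MarkovTesting

/-!
**The tester.** The statistic is the `χ²` U-statistic whose denominators are shifted by `ε / N`.
The shifted distance still satisfies `2 H² ≤ 2 χ² + ε` (`sq_sqrt_sub_sqrt_le`), so the mean per
pair of samples, which is `χ²`, is `0` if `p = q` and at least `ε / 2` if `H²(p, q) ≥ ε`. The
variance of a U-statistic (`iidMean_pairStat_sub_sq_le`) involves only the second moment of the
kernel and the variance of its projection; the shift bounds both, and Chebyshev's inequality gives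
the sample size `√N / ε`.

**The sampler.** A transition is recorded exactly when its first state is not yet full, a
condition on the past, so every recorded transition is a fresh step of the chain. Hence on the
event that all states get full, the recorded transitions are dominated by independent edges
(`expect_collect_le`), and drawing the histogram first and then one step from each of its
members is the same as drawing independent samples of `edgeDist P` (`iidSamples_bind_edgeSamples`).
As missing transitions lead to rejection, this already settles soundness, for every chain `P`:
`1 - ρ(√(P ∘ Q))` is at most the squared Hellinger distance of the edge distributions, because
`1 - H²` is the Rayleigh quotient of `√(P ∘ Q)` at the all-one vector
(`one_sub_specRadius_le_hellingerSq`).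

For completeness, all states have to get full with high probability. The number of departures
from a state `r` is controlled by the potential `1 + E_s[time to hit r] / (h + 1)`, which lies in
`[1, 2]`. It falls in expectation by `1 / (h + 1)` at every step from another state, and Kac's
formula (`sum_mul_meanHit`) bounds its growth at a step from `r` by `(n - 1) / (h + 1)`. This
yields the bound `2 exp (n K / (h + 1) - t / (2 (h + 1)))` on the probability of fewer than `K`
departures in `t` steps (`expect_departures_lt_le`), which survives a union bound over the states for
`K = t / (4 n)`. With high probability the histogram has no entry above this `K`, by a Chernoff
bound (`expect_le_count_le`).
-/

namespace MarkovTesting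

noncomputable section

/-! ### Expectations of nonnegative functions -/

/-- The expectation of a nonnegative extended-real function under a discrete distribution. -/
def expect {α : Type*} (p : PMF α) (f : α → ℝ≥0∞) : ℝ≥0∞ := ∑' a, p a * f a

section Expect

variable {α β : Type*}

lemma bind_apply_eq_expect (p : PMF α) (f : α → PMF β) (b : β) :
    (p.bind f) b = expect p fun a => f a b := rfl

@[simp] lemma expect_pure (a : α) (f : α → ℝ≥0∞) : expect (PMF.pure a) f = f a := by
  classical
  unfold expect
  rw [tsum_eq_single a]
  · simp
  · intro b hb
    simp [hb]

lemma expect_bind (p : PMF α) (g : α → PMF β) (f : β → ℝ≥0∞) :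
    expect (p.bind g) f = expect p fun a => expect (g a) f := by
  simp only [expect, PMF.bind_apply, ← ENNReal.tsum_mul_right, ← ENNReal.tsum_mul_left, mul_assoc]
  rw [ENNReal.tsum_comm]

lemma expect_map (p : PMF α) (g : α → β) (f : β → ℝ≥0∞) :
    expect (p.map g) f = expect p fun a => f (g a) := by
  rw [← PMF.bind_pure_comp, expect_bind]
  simp

@[simp] lemma expect_const (p : PMF α) (c : ℝ≥0∞) : expect p (fun _ => c) = c := by
  simp [expect, ENNReal.tsum_mul_right, p.tsum_coe]

lemma expect_mono (p : PMF α) {f g : α → ℝ≥0∞} (h : ∀ a, f a ≤ g a) :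
    expect p f ≤ expect p g :=
  ENNReal.tsum_le_tsum fun a => by gcongr; exact h a

lemma expect_mono_of_support (p : PMF α) {f g : α → ℝ≥0∞} (h : ∀ a ∈ p.support, f a ≤ g a) :
    expect p f ≤ expect p g := by
  refine ENNReal.tsum_le_tsum fun a => ?_
  by_cases ha : p a = 0
  · simp [ha]
  · gcongr
    exact h a ((PMF.mem_support_iff p a).2 ha)

lemma expect_congr_of_support (p : PMF α) {f g : α → ℝ≥0∞} (h : ∀ a ∈ p.support, f a = g a) :
    expect p f = expect p g := by
  refine tsum_congr fun a => ?_
  by_cases ha : p a = 0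
  · simp [ha]
  · rw [h a ((PMF.mem_support_iff p a).2 ha)]

lemma expect_add (p : PMF α) (f g : α → ℝ≥0∞) :
    expect p (fun a => f a + g a) = expect p f + expect p g := by
  simp only [expect, mul_add]
  exact ENNReal.tsum_add

lemma expect_finset_sum {ι : Type*} (p : PMF α) (s : Finset ι) (f : ι → α → ℝ≥0∞) :
    expect p (fun a => ∑ i ∈ s, f i a) = ∑ i ∈ s, expect p (f i) := by
  classical
  induction s using Finset.induction_on with
  | empty => simp
  | insert i s hi ih => simp only [Finset.sum_insert hi, expect_add, ih]

lemma expect_const_mul (p : PMF α) (c : ℝ≥0∞) (f : α → ℝ≥0∞) :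
    expect p (fun a => c * f a) = c * expect p f := by
  simp only [expect, ← ENNReal.tsum_mul_left]
  exact tsum_congr fun a => mul_left_comm _ _ _

lemma expect_comm (p : PMF α) (q : PMF β) (f : α → β → ℝ≥0∞) :
    expect p (fun a => expect q fun b => f a b) = expect q fun b => expect p fun a => f a b := by
  simp only [expect, ← ENNReal.tsum_mul_left]
  rw [ENNReal.tsum_comm]
  simp only [mul_left_comm]

lemma expect_tsum {ι : Type*} (p : PMF α) (f : ι → α → ℝ≥0∞) :
    expect p (fun a => ∑' i, f i a) = ∑' i, expect p (f i) := by
  simp only [expect, ← ENNReal.tsum_mul_left]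
  rw [ENNReal.tsum_comm]

lemma expect_eq_sum [Fintype α] (p : PMF α) (f : α → ℝ≥0∞) :
    expect p f = ∑ a, p a * f a := by
  rw [expect, tsum_fintype]

lemma expect_ofReal [Fintype α] (p : PMF α) {f : α → ℝ} (hf : ∀ a, 0 ≤ f a) :
    expect p (fun a => ENNReal.ofReal (f a)) = ENNReal.ofReal (∑ a, (p a).toReal * f a) := by
  rw [expect_eq_sum, ENNReal.ofReal_sum_of_nonneg
    fun a _ => mul_nonneg ENNReal.toReal_nonneg (hf a)]
  refine Finset.sum_congr rfl fun a _ => ?_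
  rw [ENNReal.ofReal_mul ENNReal.toReal_nonneg, ENNReal.ofReal_toReal (p.apply_ne_top a)]

lemma sum_toReal_eq_one [Fintype α] (p : PMF α) : ∑ a, (p a).toReal = 1 := by
  rw [← ENNReal.toReal_sum fun a _ => p.apply_ne_top a,
    ← tsum_fintype (L := .unconditional α), p.tsum_coe, ENNReal.toReal_one]

lemma apply_true_add_apply_false (p : PMF Bool) : p true + p false = 1 := by
  rw [← p.tsum_coe, tsum_fintype, Fintype.sum_bool]

end Expect

/-! ### The recorded transitions are dominated by independent samples -/

section Coupling

variable {n : ℕ}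

/-- The law of the list `[s₁, …, s_t]` of the next `t` states of the chain at `s`, that is,
`walk P t s` without the starting state. -/
def steps (P : Chain n) : ℕ → Fin n → PMF (List (Fin n))
  | 0, _ => PMF.pure []
  | t + 1, s => (P s).bind fun s' => (steps P t s').map (List.cons s')

lemma walk_eq_map_steps (P : Chain n) (t : ℕ) (s : Fin n) :
    walk P t s = (steps P t s).map (List.cons s) := by
  induction t generalizing s with
  | zero => simp [walk, steps, PMF.pure_map]
  | succ t ih => simp only [walk, steps, ih, PMF.map_bind]

lemma length_of_mem_support_steps (P : Chain n) (t : ℕ) (s : Fin n) :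
    ∀ u ∈ (steps P t s).support, u.length = t := by
  induction t generalizing s with
  | zero => simp [steps]
  | succ t ih =>
    intro u hu
    simp only [steps, PMF.mem_support_bind_iff, PMF.mem_support_map_iff] at hu
    obtain ⟨s', -, u', hu', rfl⟩ := hu
    simp [ih s' u' hu']

/-- The law of the multiset of edges obtained from a multiset `R` of states by an independent step
of the chain from every member of `R`. -/
def edgeSamples (P : Chain n) (R : Multiset (Fin n)) : PMF (Multiset (Fin n × Fin n)) :=
  haveI : LeftCommutative fun (i : Fin n) (ν : PMF (Multiset (Fin n × Fin n))) =>
      (P i).bind fun j => ν.map (Multiset.cons (i, j)) :=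
    ⟨fun i i' ν => by
      simp only [PMF.map_bind, PMF.map_comp]
      rw [PMF.bind_comm]
      refine congrArg _ (funext fun j => congrArg _ (funext fun j' => congrArg (ν.map ·) ?_))
      funext M
      exact Multiset.cons_swap _ _ _⟩
  R.foldr (fun i ν => (P i).bind fun j => ν.map (Multiset.cons (i, j))) (PMF.pure 0)

@[simp] lemma edgeSamples_zero (P : Chain n) : edgeSamples P 0 = PMF.pure 0 := rfl

lemma edgeSamples_cons (P : Chain n) (i : Fin n) (R : Multiset (Fin n)) :
    edgeSamples P (i ::ₘ R) =
      (P i).bind fun j => (edgeSamples P R).map (Multiset.cons (i, j)) := by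
  simp only [edgeSamples, Multiset.foldr_cons]

/-- Independent edges can be sampled by first drawing the multiset of their first states. -/
lemma iidSamples_bind_edgeSamples [NeZero n] (P : Chain n) (k : ℕ) :
    (iidSamples (PMF.uniformOfFintype (Fin n)) k).bind (edgeSamples P) =
      iidSamples (edgeDist P) k := by
  induction k with
  | zero => simp [iidSamples]
  | succ k ih =>
    rw [iidSamples, iidSamples, ← ih]
    simp only [edgeDist, PMF.bind_bind, PMF.bind_map, PMF.map_bind, Function.comp_def,
      edgeSamples_cons]
    refine congrArg _ (funext fun i => ?_)
    rw [PMF.bind_comm]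

/-- The value of `g` at the multiset of all recorded transitions if every state `i` has its full
number `k i` of them, and `0` otherwise. -/
def evalIfFull (k : Fin n → ℕ) (g : Multiset (Fin n × Fin n) → ℝ≥0∞)
    (S : Fin n → Multiset (Fin n × Fin n)) : ℝ≥0∞ :=
  if ∃ i, (S i).card < k i then 0 else g (∑ i, S i)

/-- The transitions recorded on the event that all states get their full number of transitions are
dominated by independent samples: as long as a state `i` is not full, the transition that is
recorded when the chain leaves `i` is a fresh step from `i`. The multiset `R` holds the
first states of the transitions that are still to be recorded. -/
lemma expect_collect_le (P : Chain n) (k : Fin n → ℕ) (g : Multiset (Fin n × Fin n) → ℝ≥0∞)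
    (t : ℕ) (s : Fin n) (S : Fin n → Multiset (Fin n × Fin n)) (R : Multiset (Fin n))
    (hR : ∀ i, R.count i + (S i).card = k i) :
    expect (steps P t s) (fun u =>
        evalIfFull k g (((s :: u).zip u).foldl (addEdge k) S)) ≤
      expect (edgeSamples P R) fun X => g (X + ∑ i, S i) := by
  induction t generalizing s S R with
  | zero =>
    simp only [steps, expect_pure, List.zip_nil_right, List.foldl_nil, evalIfFull]
    split_ifs with h
    · exact zero_le
    · push Not at h
      have hR0 : R = 0 := by
        refine Multiset.eq_zero_of_forall_notMem fun i hi => ?_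
        have := Multiset.count_pos.2 hi
        have := h i
        have := hR i
        omega
      simp [hR0]
  | succ t ih =>
    simp only [steps, expect_bind, expect_map, List.zip_cons_cons, List.foldl_cons]
    -- If `s` is not full, the step from `s` is one of the samples still to be drawn; otherwise it
    -- leaves the record unchanged.
    by_cases hs : (S s).card < k s
    · have hsR : s ∈ R := Multiset.count_pos.1 (by have := hR s; omega)
      obtain ⟨R', rfl⟩ := Multiset.exists_cons_of_mem hsR
      rw [edgeSamples_cons, expect_bind]
      refine expect_mono _ fun s' => ?_
      have hadd : addEdge k S (s, s') = Function.update S s ((s, s') ::ₘ S s) := by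
        simp [addEdge, hs]
      rw [hadd]
      refine (ih s' _ R' fun i => ?_).trans (le_of_eq ?_)
      · have := hR i
        rcases eq_or_ne i s with rfl | hi
        · simp only [Multiset.count_cons_self, Function.update_self, Multiset.card_cons] at this ⊢
          omega
        · simpa [hi] using this
      · rw [expect_map]
        congr 1
        funext X
        congr 1
        rw [← Finset.add_sum_erase _ _ (Finset.mem_univ s),
          ← Finset.add_sum_erase _ S (Finset.mem_univ s), Function.update_self,
          Finset.sum_congr rfl fun i hi => Function.update_of_ne (Finset.ne_of_mem_erase hi) _ _]
        simp only [Multiset.cons_add, Multiset.add_cons]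
    · calc _ ≤ expect (P s) fun _ => expect (edgeSamples P R) fun X => g (X + ∑ i, S i) := by
            refine expect_mono _ fun s' => ?_
            have hadd : addEdge k S (s, s') = S := by simp [addEdge, hs]
            rw [hadd]
            exact ih s' S R hR
        _ = _ := expect_const _ _

/-- A state whose number of recorded transitions stays below its target has had all its transitions
recorded. -/
lemma countP_le_card_foldl_addEdge (k : Fin n → ℕ) (l : List (Fin n × Fin n))
    (S : Fin n → Multiset (Fin n × Fin n)) (i : Fin n)
    (h : ((l.foldl (addEdge k) S) i).card < k i) :
    l.countP (fun e => e.1 = i) + (S i).card ≤ ((l.foldl (addEdge k) S) i).card := by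
  induction l generalizing S with
  | nil => simp
  | cons e l ih =>
    rw [List.foldl_cons] at h ⊢
    have ih := ih (addEdge k S e) h
    rw [List.countP_cons]
    by_cases he : e.1 = i
    · subst he
      by_cases hS : (S e.1).card < k e.1
      · simp only [addEdge, hS, if_true, Function.update_self, Multiset.card_cons] at ih ⊢
        simp only [decide_true, if_true]
        omega
      · have : addEdge k S e = S := by simp [addEdge, hS]
        rw [this] at ih h
        omega
    · have : (addEdge k S e i) = S i := by
        unfold addEdge
        split_ifs
        · rw [Function.update_of_ne (Ne.symm he)]
        · rfl
      rw [this] at ih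
      simpa [he] using ih

end Coupling

/-! ### Hitting times and the number of visits to a state -/

section Hitting

variable {n : ℕ} {P : Chain n} {r s : Fin n}

lemma firstVisitProb_self_zero (P : Chain n) (r : Fin n) : firstVisitProb P r r 0 = 1 := by
  simp [firstVisitProb, walk, PMF.toOuterMeasure_pure_apply]

lemma firstVisitProb_self_succ (P : Chain n) (r : Fin n) (t : ℕ) :
    firstVisitProb P r r (t + 1) = 0 := by
  simp [firstVisitProb, walk, PMF.toOuterMeasure_bind_apply, Set.preimage]

lemma firstVisitProb_zero (P : Chain n) (h : s ≠ r) : firstVisitProb P s r 0 = 0 := by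
  simp [firstVisitProb, walk, PMF.toOuterMeasure_pure_apply, h]

lemma firstVisitProb_succ (P : Chain n) (h : s ≠ r) (t : ℕ) :
    firstVisitProb P s r (t + 1) = expect (P s) fun j => firstVisitProb P j r t := by
  simp [firstVisitProb, walk, PMF.toOuterMeasure_bind_apply, Set.preimage, h, expect]

lemma sum_firstVisitProb_le_one (P : Chain n) (s r : Fin n) (T : ℕ) :
    ∑ t ∈ Finset.range T, firstVisitProb P s r t ≤ 1 := by
  induction T generalizing s with
  | zero => simp
  | succ T ih =>
    rw [Finset.sum_range_succ']
    rcases eq_or_ne s r with rfl | h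
    · simp [firstVisitProb_self_zero, firstVisitProb_self_succ]
    · rw [firstVisitProb_zero P h, add_zero, Finset.sum_congr rfl fun t _ =>
        firstVisitProb_succ P h t, ← expect_finset_sum]
      exact (expect_mono _ ih).trans_eq (expect_const _ _)

lemma expectedVisitTime_ne_top (h : hittingTime P ≠ ⊤) (s r : Fin n) :
    expectedVisitTime P s r ≠ ⊤ :=
  ne_top_of_le_ne_top h (le_iSup₂ (f := fun r s => expectedVisitTime P s r) r s)

lemma tsum_firstVisitProb (h : hittingTime P ≠ ⊤) (s r : Fin n) :
    ∑' t, firstVisitProb P s r t = 1 := by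
  refine le_antisymm (ENNReal.tsum_le_of_sum_range_le fun T => sum_firstVisitProb_le_one P s r T) ?_
  by_contra! hlt
  refine expectedVisitTime_ne_top h s r ?_
  rw [expectedVisitTime, ENNReal.top_mul (tsub_pos_of_lt hlt).ne', add_top]

lemma expectedVisitTime_eq_tsum (h : hittingTime P ≠ ⊤) (s r : Fin n) :
    expectedVisitTime P s r = ∑' t : ℕ, (t : ℝ≥0∞) * firstVisitProb P s r t := by
  simp [expectedVisitTime, tsum_firstVisitProb h]

lemma expectedVisitTime_self (h : hittingTime P ≠ ⊤) (r : Fin n) :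
    expectedVisitTime P r r = 0 := by
  rw [expectedVisitTime_eq_tsum h, ENNReal.tsum_eq_zero]
  rintro (_ | t)
  · simp
  · simp [firstVisitProb_self_succ]

lemma expectedVisitTime_eq_one_add (h : hittingTime P ≠ ⊤) (hs : s ≠ r) :
    expectedVisitTime P s r = 1 + expect (P s) fun j => expectedVisitTime P j r := by
  rw [expectedVisitTime_eq_tsum h, tsum_eq_zero_add' ENNReal.summable]
  simp only [firstVisitProb_succ P hs, ← expect_const_mul, ← expect_tsum,
    expectedVisitTime_eq_tsum h]
  rw [← expect_const (P s) 1, ← expect_add]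
  simp only [Nat.cast_zero, zero_mul, zero_add, Nat.cast_add, Nat.cast_one, add_mul, one_mul,
    ENNReal.tsum_add, tsum_firstVisitProb h, add_comm]

/-- The expected time to reach `r` from `s`, as a real number. -/
def meanHit (P : Chain n) (r s : Fin n) : ℝ := (expectedVisitTime P s r).toReal

lemma meanHit_nonneg (P : Chain n) (r s : Fin n) : 0 ≤ meanHit P r s := ENNReal.toReal_nonneg

lemma meanHit_le (h : hittingTime P ≠ ⊤) (r s : Fin n) :
    meanHit P r s ≤ (hittingTime P).toReal :=
  ENNReal.toReal_mono h (le_iSup₂ (f := fun r s => expectedVisitTime P s r) r s)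

lemma meanHit_self (h : hittingTime P ≠ ⊤) (r : Fin n) : meanHit P r r = 0 := by
  simp [meanHit, expectedVisitTime_self h]

lemma meanHit_eq_one_add (h : hittingTime P ≠ ⊤) (hs : s ≠ r) :
    meanHit P r s = 1 + ∑ j, (P s j).toReal * meanHit P r j := by
  have hne : ∀ j, P s j * expectedVisitTime P j r ≠ ⊤ := fun j =>
    ENNReal.mul_ne_top ((P s).apply_ne_top j) (expectedVisitTime_ne_top h j r)
  rw [meanHit, expectedVisitTime_eq_one_add h hs, expect_eq_sum,
    ENNReal.toReal_add ENNReal.one_ne_top (ENNReal.sum_ne_top.2 fun j _ => hne j),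
    ENNReal.toReal_sum fun j _ => hne j]
  simp [meanHit, ENNReal.toReal_mul]

/-- Kac's formula for a symmetric chain, whose stationary distribution is uniform: the expected
return time of every state is `n`. -/
lemma sum_mul_meanHit (hP : P.Symmetric) (h : hittingTime P ≠ ⊤) (r : Fin n) :
    ∑ j, (P r j).toReal * meanHit P r j = n - 1 := by
  have hcol : ∑ s, ∑ j, (P s j).toReal * meanHit P r j = ∑ j, meanHit P r j := by
    rw [Finset.sum_comm]
    refine Finset.sum_congr rfl fun j _ => ?_
    simp only [hP _ j, ← Finset.sum_mul, sum_toReal_eq_one, one_mul]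
  have hrow : ∑ s ∈ Finset.univ.erase r, meanHit P r s =
      (n - 1) + ∑ s ∈ Finset.univ.erase r, ∑ j, (P s j).toReal * meanHit P r j := by
    rw [Finset.sum_congr rfl fun s hs => meanHit_eq_one_add h (Finset.ne_of_mem_erase hs),
      Finset.sum_add_distrib]
    simp [Finset.card_erase_of_mem, Nat.cast_sub (Nat.one_le_iff_ne_zero.2 r.pos.ne')]
  have h1 := Finset.add_sum_erase Finset.univ (fun s => ∑ j, (P s j).toReal * meanHit P r j)
    (Finset.mem_univ r)
  have h2 := Finset.add_sum_erase Finset.univ (meanHit P r) (Finset.mem_univ r)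
  rw [meanHit_self h] at h2
  linarith

/-- An exponential bound for the lower tail of the number of departures from `r`, from a potential
`ψ` that grows in expectation by a factor of at most `e^{-lam}` along every step, up to a factor of
`e^a` for a step from `r`. -/
lemma expect_countP_lt_le (P : Chain n) (r : Fin n) {ψ : Fin n → ℝ} {a lam : ℝ} (ha : 0 ≤ a)
    (hψ : ∀ s, 1 ≤ ψ s)
    (hstep : ∀ s, s ≠ r → Real.exp lam * ∑ j, (P s j).toReal * ψ j ≤ ψ s)
    (hr : Real.exp lam * ∑ j, (P r j).toReal * ψ j ≤ Real.exp a * ψ r) (t K : ℕ) (s : Fin n) :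
    expect (steps P t s) (fun u => if ((s :: u).zip u).countP (fun e => e.1 = r) < K
      then 1 else 0) ≤ ENNReal.ofReal (ψ s * Real.exp (a * K - lam * t)) := by
  have hψ0 : ∀ s, 0 ≤ ψ s := fun s => zero_le_one.trans (hψ s)
  induction t generalizing s K with
  | zero =>
    simp only [steps, expect_pure, List.zip_nil_right, List.countP_nil]
    split_ifs
    · rw [ENNReal.one_le_ofReal]
      refine one_le_mul_of_one_le_of_one_le (hψ s) (Real.one_le_exp ?_)
      simp only [Nat.cast_zero, mul_zero, sub_zero]
      positivity
    · exact zero_le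
  | succ t ih =>
    simp only [steps, expect_bind, expect_map, List.zip_cons_cons, List.countP_cons]
    have key : ∀ c : ℝ, expect (P s) (fun j => ENNReal.ofReal (ψ j * Real.exp (c - lam * t))) =
        ENNReal.ofReal (Real.exp lam * (∑ j, (P s j).toReal * ψ j) *
          Real.exp (c - lam * (t + 1 : ℕ))) := fun c => by
      rw [expect_ofReal _ fun j => mul_nonneg (hψ0 j) (Real.exp_pos _).le]
      congr 1
      have : Real.exp (c - lam * t) = Real.exp lam * Real.exp (c - lam * (t + 1 : ℕ)) := by
        rw [← Real.exp_add]; congr 1; push_cast; ring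
      rw [this]
      simp only [← mul_assoc, ← Finset.sum_mul]
      ring
    rcases eq_or_ne s r with rfl | hs
    · rcases K with _ | K
      · simp
      · simp only [decide_true, if_true, Nat.add_lt_add_iff_right]
        refine ((expect_mono _ fun j => ih K j).trans_eq (key _)).trans (ENNReal.ofReal_le_ofReal ?_)
        calc _ ≤ Real.exp a * ψ s * Real.exp (a * K - lam * (t + 1 : ℕ)) := by gcongr
          _ = _ := by
            rw [mul_comm (Real.exp a), mul_assoc, ← Real.exp_add]
            congr 2
            push_cast
            ring
    · simp only [hs, decide_false, Bool.false_eq_true, if_false, add_zero]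
      refine ((expect_mono _ fun j => ih K j).trans_eq (key _)).trans (ENNReal.ofReal_le_ofReal ?_)
      gcongr
      exact hstep s hs

/-- The potential `1 + E_s[time to hit r] / (h + 1)` decreases by `1 / (h + 1)` along every step
from a state other than `r`, and by Kac's formula it increases by `(n - 1) / (h + 1)` along a step
from `r`. -/
lemma expect_departures_lt_le (hP : P.Symmetric) (h : hittingTime P ≠ ⊤) (r s : Fin n) (t K : ℕ) :
    expect (steps P t s) (fun u => if ((s :: u).zip u).countP (fun e => e.1 = r) < K
      then 1 else 0) ≤ ENNReal.ofReal (2 * Real.exp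
        (n * K / ((hittingTime P).toReal + 1) - t / (2 * ((hittingTime P).toReal + 1)))) := by
  set b : ℝ := 1 / ((hittingTime P).toReal + 1) with hb
  have hh : 0 < (hittingTime P).toReal + 1 := by positivity
  have hb0 : 0 < b := by positivity
  have hbh : ∀ s, b * meanHit P r s ≤ 1 := fun s => by
    rw [hb, one_div_mul_eq_div, div_le_one hh]
    linarith [meanHit_le h r s]
  have hbh0 : ∀ s, 0 ≤ b * meanHit P r s := fun s => mul_nonneg hb0.le (meanHit_nonneg P r s)
  have hsum : ∀ s, ∑ j, (P s j).toReal * (1 + b * meanHit P r j) =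
      1 + b * ∑ j, (P s j).toReal * meanHit P r j := fun s => by
    simp only [mul_add, mul_one, Finset.sum_add_distrib, sum_toReal_eq_one, Finset.mul_sum]
    congr 1
    exact Finset.sum_congr rfl fun j _ => by ring
  refine (expect_countP_lt_le P r (ψ := fun s => 1 + b * meanHit P r s) (a := n * b)
    (lam := b / 2) (by positivity) (fun s => by linarith [hbh0 s]) (fun s hs => ?_) ?_ t K s).trans
    (ENNReal.ofReal_le_ofReal ?_)
  · rw [hsum]
    have h1 := meanHit_eq_one_add h hs
    set ψ := 1 + b * meanHit P r s with hψ
    have hψ1 : 1 ≤ ψ := by linarith [hbh0 s]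
    have hψ2 : ψ ≤ 2 := by linarith [hbh s]
    have h2 : 1 + b * ∑ j, (P s j).toReal * meanHit P r j = ψ * (1 - b / ψ) := by
      rw [mul_sub, mul_div_cancel₀ _ (by positivity), hψ, h1]
      ring
    have h3 : b / 2 ≤ b / ψ := by gcongr
    calc Real.exp (b / 2) * (1 + b * ∑ j, (P s j).toReal * meanHit P r j)
        ≤ Real.exp (b / ψ) * (ψ * Real.exp (-(b / ψ))) := by
          rw [h2]
          have := Real.add_one_le_exp (-(b / ψ))
          have h4 : ψ * (1 - b / ψ) ≤ ψ * Real.exp (-(b / ψ)) := by gcongr; linarith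
          calc _ ≤ Real.exp (b / 2) * (ψ * Real.exp (-(b / ψ))) := by gcongr
            _ ≤ _ := by gcongr
      _ = ψ := by rw [Real.exp_neg]; field_simp
  · rw [hsum, sum_mul_meanHit hP h, meanHit_self h]
    have := Real.add_one_le_exp (b * (n - 1))
    calc _ ≤ Real.exp (b / 2) * Real.exp (b * (n - 1)) := by gcongr; linarith
      _ = Real.exp (b / 2 + b * (n - 1)) := (Real.exp_add _ _).symm
      _ ≤ Real.exp (n * b) := by gcongr; linarith
      _ = _ := by ring
  · have : (n : ℝ) * b * K - b / 2 * t = n * K / ((hittingTime P).toReal + 1) -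
        t / (2 * ((hittingTime P).toReal + 1)) := by
      rw [hb]; field_simp
    rw [this]
    gcongr
    linarith [hbh s]

end Hitting

/-! ### The Hellinger distance of the edge distributions -/

section Spectral

variable {n : ℕ}

open scoped Matrix.Norms.L2Operator in
/-- The Rayleigh quotient of the all-one vector is at most the spectral radius. -/
lemma sum_le_mul_specRadius {A : Matrix (Fin n) (Fin n) ℝ} (hA : A.IsSymm) :
    ∑ i, ∑ j, A i j ≤ n * specRadius A := by
  set B := A.map Complex.ofReal with hB
  have hsa : IsSelfAdjoint B := by
    ext i j
    simp [hB, Matrix.star_apply, hA.apply i j]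
  have hrad : specRadius A = ‖B‖ := by
    rw [specRadius, hsa.spectralRadius_eq_nnnorm]
    rfl
  set x : EuclideanSpace ℂ (Fin n) := WithLp.toLp 2 fun _ => 1 with hx
  have hxn : ‖x‖ * ‖x‖ = n := by
    rw [← sq, EuclideanSpace.norm_sq_eq]
    simp [hx]
  have h1 : inner ℂ x (WithLp.toLp 2 (B.mulVec x.ofLp)) = ((∑ i, ∑ j, A i j : ℝ) : ℂ) := by
    simp [hx, hB, PiLp.inner_apply, Matrix.mulVec, dotProduct]
  calc ∑ i, ∑ j, A i j ≤ ‖((∑ i, ∑ j, A i j : ℝ) : ℂ)‖ := by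
        rw [Complex.norm_real]
        exact le_abs_self _
    _ ≤ ‖x‖ * ‖WithLp.toLp 2 (B.mulVec x.ofLp)‖ := by
        rw [← h1]
        exact norm_inner_le_norm _ _
    _ ≤ ‖x‖ * (‖B‖ * ‖x‖) := by
        gcongr
        exact Matrix.l2_opNorm_mulVec B x
    _ = n * specRadius A := by
        rw [hrad, ← hxn]
        ring

lemma edgeDist_apply [NeZero n] (P : Chain n) (i j : Fin n) :
    edgeDist P (i, j) = (n : ℝ≥0∞)⁻¹ * P i j := by
  rw [edgeDist, PMF.bind_apply, tsum_eq_single i]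
  · congr 1
    · simp
    · rw [PMF.map_apply, tsum_eq_single j]
      · simp
      · intro j' hj'
        simp [hj'.symm]
  · intro i' hi'
    rw [PMF.map_apply, ENNReal.tsum_eq_zero.2, mul_zero]
    intro j'
    simp [hi'.symm]

lemma hellingerSq_eq {α : Type} [Fintype α] (p q : PMF α) :
    hellingerSq p q = 1 - ∑ x, √((p x).toReal * (q x).toReal) := by
  have h : ∀ x, (√(p x).toReal - √(q x).toReal) ^ 2 =
      (p x).toReal + (q x).toReal - 2 * √((p x).toReal * (q x).toReal) := fun x => by
    rw [sub_sq, Real.sq_sqrt ENNReal.toReal_nonneg, Real.sq_sqrt ENNReal.toReal_nonneg,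
      Real.sqrt_mul ENNReal.toReal_nonneg]
    ring
  simp only [hellingerSq, h, Finset.sum_sub_distrib, Finset.sum_add_distrib, sum_toReal_eq_one,
    ← Finset.mul_sum]
  ring

/-- The Hellinger affinity of the edge distributions is the Rayleigh quotient of `√(P ∘ Q)` at the
all-one vector. -/
lemma one_sub_specRadius_le_hellingerSq [NeZero n] {P Q : Chain n} (hP : P.Symmetric)
    (hQ : Q.Symmetric) :
    1 - specRadius (sqrtProd P Q) ≤ hellingerSq (edgeDist P) (edgeDist Q) := by
  have hn : (0 : ℝ) < n := Nat.cast_pos.2 (NeZero.pos n)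
  have hsymm : (sqrtProd P Q).IsSymm := by
    ext i j
    simp [sqrtProd, hP i j, hQ i j]
  have hentry : ∀ i j, √((edgeDist P (i, j)).toReal * (edgeDist Q (i, j)).toReal) =
      (n : ℝ)⁻¹ * sqrtProd P Q i j := fun i j => by
    simp only [edgeDist_apply, ENNReal.toReal_mul, ENNReal.toReal_inv, ENNReal.toReal_natCast,
      sqrtProd, Matrix.of_apply]
    rw [mul_mul_mul_comm, Real.sqrt_mul (by positivity), Real.sqrt_mul_self (by positivity)]
  rw [hellingerSq_eq, Fintype.sum_prod_type]
  simp only [hentry, ← Finset.mul_sum]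
  have := sum_le_mul_specRadius hsymm
  have h2 : (n : ℝ)⁻¹ * ∑ i, ∑ j, sqrtProd P Q i j ≤ specRadius (sqrtProd P Q) := by
    rw [inv_mul_le_iff₀ hn]
    exact this
  linarith

end Spectral

/-! ### The variance of a U-statistic -/

section UStatistic

variable {α : Type*} [Fintype α]

/-- The mean of a real function of the multiset of `k` independent samples with weights `p`. -/
def iidMean (p : α → ℝ) : ℕ → (Multiset α → ℝ) → ℝ
  | 0, F => F 0
  | k + 1, F => ∑ x, p x * iidMean p k fun S => F (x ::ₘ S)

variable {p : α → ℝ}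

lemma iidMean_congr {k : ℕ} {F G : Multiset α → ℝ} (h : ∀ S, S.card = k → F S = G S) :
    iidMean p k F = iidMean p k G := by
  induction k generalizing F G with
  | zero => exact h 0 rfl
  | succ k ih =>
    exact Finset.sum_congr rfl fun x _ => by rw [ih fun S hS => h _ (by simp [hS])]

lemma iidMean_add (k : ℕ) (F G : Multiset α → ℝ) :
    iidMean p k (fun S => F S + G S) = iidMean p k F + iidMean p k G := by
  induction k generalizing F G with
  | zero => rfl
  | succ k ih => simp only [iidMean, ih, mul_add, Finset.sum_add_distrib]

lemma iidMean_const_mul (k : ℕ) (c : ℝ) (F : Multiset α → ℝ) :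
    iidMean p k (fun S => c * F S) = c * iidMean p k F := by
  induction k generalizing F with
  | zero => rfl
  | succ k ih => simp only [iidMean, ih, Finset.mul_sum, mul_left_comm]

lemma iidMean_const (hp : ∑ x, p x = 1) (k : ℕ) (c : ℝ) : iidMean p k (fun _ => c) = c := by
  induction k with
  | zero => rfl
  | succ k ih => simp only [iidMean, ih, ← Finset.sum_mul, hp, one_mul]

lemma iidMean_sum {ι : Type*} (s : Finset ι) (k : ℕ) (F : ι → Multiset α → ℝ) :
    iidMean p k (fun S => ∑ i ∈ s, F i S) = ∑ i ∈ s, iidMean p k (F i) := by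
  induction k generalizing F with
  | zero => rfl
  | succ k ih =>
    simp only [iidMean, ih, Finset.mul_sum]
    exact Finset.sum_comm

lemma iidMean_succ (k : ℕ) (F : Multiset α → ℝ) :
    iidMean p (k + 1) F = iidMean p k fun S => ∑ x, p x * F (x ::ₘ S) := by
  simp only [iidMean_sum, iidMean_const_mul, iidMean]

lemma iidMean_map_sum (hp : ∑ x, p x = 1) (a : α → ℝ) (k : ℕ) :
    iidMean p k (fun S => (S.map a).sum) = k * ∑ x, p x * a x := by
  induction k with
  | zero => simp [iidMean]
  | succ k ih =>
    simp only [iidMean_succ, Multiset.map_cons, Multiset.sum_cons, mul_add, Finset.sum_add_distrib,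
      ← Finset.sum_mul, hp, one_mul, iidMean_add, iidMean_const hp, ih]
    push_cast
    ring

lemma iidMean_map_sum_sq (hp : ∑ x, p x = 1) (a : α → ℝ) (k : ℕ) :
    iidMean p k (fun S => (S.map a).sum ^ 2) =
      k * ∑ x, p x * a x ^ 2 + k * (k - 1) * (∑ x, p x * a x) ^ 2 := by
  induction k with
  | zero => simp [iidMean]
  | succ k ih =>
    have h : ∀ S : Multiset α, ∑ x, p x * ((x ::ₘ S).map a).sum ^ 2 =
        ∑ x, p x * a x ^ 2 + (2 * ∑ x, p x * a x) * (S.map a).sum + (S.map a).sum ^ 2 := fun S => by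
      calc _ = ∑ x, (p x * a x ^ 2 + 2 * (p x * a x) * (S.map a).sum +
            p x * (S.map a).sum ^ 2) := by
            refine Finset.sum_congr rfl fun x _ => ?_
            rw [Multiset.map_cons, Multiset.sum_cons]
            ring
        _ = _ := by
            simp only [Finset.sum_add_distrib, ← Finset.sum_mul, ← Finset.mul_sum, hp, one_mul]
    simp only [iidMean_succ, h, iidMean_add, iidMean_const hp, iidMean_const_mul,
      iidMean_map_sum hp, ih]
    push_cast
    ring

/-- The sum of the kernel `f` over all ordered pairs of different members of the multiset `S`. -/
def pairStat {α : Type*} (f : α → α → ℝ) (S : Multiset α) : ℝ :=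
  (S.map fun x => (S.map (f x)).sum).sum - (S.map fun x => f x x).sum

lemma pairStat_cons {α : Type*} {f : α → α → ℝ} (hf : ∀ x y, f x y = f y x) (x : α)
    (S : Multiset α) :
    pairStat f (x ::ₘ S) = pairStat f S + 2 * (S.map (f x)).sum := by
  simp only [pairStat, Multiset.map_cons, Multiset.sum_cons, Multiset.sum_map_add, hf _ x]
  ring

lemma pairStat_sub_const {α : Type*} (f : α → α → ℝ) (c : ℝ) (S : Multiset α) :
    pairStat (fun x y => f x y - c) S = pairStat f S - S.card * (S.card - 1) * c := by
  simp only [pairStat, Multiset.sum_map_sub, Multiset.map_const', Multiset.sum_replicate,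
    nsmul_eq_mul]
  ring

lemma sum_mul_map_sum (p b : α → ℝ) (f : α → α → ℝ) (S : Multiset α) :
    ∑ x, p x * (b x * (S.map (f x)).sum) = (S.map fun y => ∑ x, p x * (b x * f x y)).sum := by
  induction S using Multiset.induction_on with
  | empty => simp
  | cons y S ih => simp only [Multiset.map_cons, Multiset.sum_cons, mul_add,
      Finset.sum_add_distrib, ih]

lemma iidMean_pairStat_mul {f : α → α → ℝ} (hp : ∑ x, p x = 1) (hf : ∀ x y, f x y = f y x)
    (h0 : ∑ x, p x * ∑ y, p y * f x y = 0) (k : ℕ) :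
    iidMean p k (fun S => pairStat f S * (S.map fun x => ∑ y, p y * f x y).sum) =
      2 * k * (k - 1) * ∑ x, p x * (∑ y, p y * f x y) ^ 2 := by
  set g : α → ℝ := fun x => ∑ y, p y * f x y with hg
  induction k with
  | zero => simp [iidMean]
  | succ k ih =>
    have h1 : ∀ S : Multiset α, ∑ x, p x * (S.map (f x)).sum = (S.map g).sum := fun S => by
      have := sum_mul_map_sum p (fun _ => 1) f S
      simp only [one_mul] at this
      rw [this]
      simp only [hg, hf]
    have h : ∀ S : Multiset α, ∑ x, p x * (pairStat f (x ::ₘ S) * ((x ::ₘ S).map g).sum) =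
        pairStat f S * (S.map g).sum + 2 * (S.map g).sum ^ 2 +
          2 * (S.map fun y => ∑ x, p x * (g x * f x y)).sum := fun S => by
      calc _ = ∑ x, (p x * g x * pairStat f S + p x * (pairStat f S * (S.map g).sum) +
            2 * (p x * (S.map (f x)).sum) * (S.map g).sum +
              2 * (p x * (g x * (S.map (f x)).sum))) := by
            refine Finset.sum_congr rfl fun x _ => ?_
            rw [Multiset.map_cons, Multiset.sum_cons, pairStat_cons hf]
            ring
        _ = _ := by
            simp only [Finset.sum_add_distrib, ← Finset.sum_mul, ← Finset.mul_sum, hp, h1,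
              sum_mul_map_sum]
            have h0' : ∑ x, p x * g x = 0 := h0
            rw [h0']
            ring
    have h2 : ∑ y, p y * ∑ x, p x * (g x * f x y) = ∑ x, p x * g x ^ 2 := by
      simp only [Finset.mul_sum]
      rw [Finset.sum_comm]
      refine Finset.sum_congr rfl fun x _ => ?_
      calc _ = p x * g x * ∑ y, p y * f x y := by
            rw [Finset.mul_sum]
            exact Finset.sum_congr rfl fun y _ => by ring
        _ = p x * g x ^ 2 := by
            rw [sq, ← mul_assoc]
    have h0' : ∑ x, p x * g x = 0 := h0
    simp only [iidMean_succ, h, iidMean_add, iidMean_const_mul, iidMean_map_sum_sq hp,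
      iidMean_map_sum hp, h2, h0', ih]
    push_cast
    ring

lemma iidMean_pairStat_sq {f : α → α → ℝ} (hp : ∑ x, p x = 1) (hf : ∀ x y, f x y = f y x)
    (h0 : ∑ x, p x * ∑ y, p y * f x y = 0) (k : ℕ) :
    iidMean p k (fun S => pairStat f S ^ 2) =
      2 * k * (k - 1) * ∑ x, p x * ∑ y, p y * f x y ^ 2 +
      4 * k * (k - 1) * (k - 2) * ∑ x, p x * (∑ y, p y * f x y) ^ 2 := by
  induction k with
  | zero => simp [iidMean, pairStat]
  | succ k ih =>
    have h1 : ∀ S : Multiset α, ∑ x, p x * (S.map (f x)).sum =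
        (S.map fun x => ∑ y, p y * f x y).sum := fun S => by
      have := sum_mul_map_sum p (fun _ => 1) f S
      simp only [one_mul] at this
      rw [this]
      simp only [hf]
    have h : ∀ S : Multiset α, ∑ x, p x * pairStat f (x ::ₘ S) ^ 2 =
        pairStat f S ^ 2 + 4 * (pairStat f S * (S.map fun x => ∑ y, p y * f x y).sum) +
          4 * ∑ x, p x * (S.map (f x)).sum ^ 2 := fun S => by
      rw [← h1]
      calc _ = ∑ x, (p x * pairStat f S ^ 2 + 4 * (pairStat f S * (p x * (S.map (f x)).sum)) +
              4 * (p x * (S.map (f x)).sum ^ 2)) := by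
            refine Finset.sum_congr rfl fun x _ => ?_
            rw [pairStat_cons hf]
            ring
        _ = _ := by
            simp only [Finset.sum_add_distrib, ← Finset.sum_mul, ← Finset.mul_sum, hp, one_mul]
    simp only [iidMean_succ, h, iidMean_add, iidMean_const_mul, iidMean_sum,
      iidMean_map_sum_sq hp, iidMean_pairStat_mul hp hf h0, ih]
    have h3 : ∑ x, p x * (k * ∑ y, p y * f x y ^ 2 + k * (k - 1) * (∑ y, p y * f x y) ^ 2) =
        k * (∑ x, p x * ∑ y, p y * f x y ^ 2) +
          k * (k - 1) * ∑ x, p x * (∑ y, p y * f x y) ^ 2 := by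
      simp only [mul_add, Finset.sum_add_distrib, Finset.mul_sum]
      congr 1
      · exact Finset.sum_congr rfl fun x _ => Finset.sum_congr rfl fun y _ => by ring
      · exact Finset.sum_congr rfl fun x _ => by ring
    rw [h3]
    push_cast
    ring

lemma sum_mul_sub_mean_sq_le (hp : ∑ x, p x = 1) (a : α → ℝ) :
    ∑ x, p x * (a x - ∑ y, p y * a y) ^ 2 ≤ ∑ x, p x * a x ^ 2 := by
  have h : ∑ x, p x * (a x - ∑ y, p y * a y) ^ 2 =
      ∑ x, p x * a x ^ 2 - (∑ y, p y * a y) ^ 2 := by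
    set m := ∑ y, p y * a y with hm
    calc _ = ∑ x, (p x * a x ^ 2 - p x * a x * (2 * m) + p x * m ^ 2) :=
          Finset.sum_congr rfl fun x _ => by ring
      _ = _ := by
          simp only [Finset.sum_add_distrib, Finset.sum_sub_distrib, ← Finset.sum_mul, hp, ← hm]
          ring
  rw [h]
  linarith [sq_nonneg (∑ y, p y * a y)]

/-- The variance of a U-statistic: pairs of pairs without a common sample are uncorrelated, those
with one common sample contribute the variance of the projected kernel. -/
lemma iidMean_pairStat_sub_sq_le (hp : ∑ x, p x = 1) {f : α → α → ℝ}
    (hf : ∀ x y, f x y = f y x) {c : ℝ} (hc : ∑ x, p x * ∑ y, p y * f x y = c) (k : ℕ)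
    (hk : 1 ≤ k) :
    iidMean p k (fun S => (pairStat f S - k * (k - 1) * c) ^ 2) ≤
      2 * k * (k - 1) * ∑ x, p x * ∑ y, p y * f x y ^ 2 +
      4 * k * (k - 1) * (k - 2) * ∑ x, p x * ((∑ y, p y * f x y) - c) ^ 2 := by
  have hg : ∀ x, ∑ y, p y * (f x y - c) = (∑ y, p y * f x y) - c := fun x => by
    simp only [mul_sub, Finset.sum_sub_distrib, ← Finset.sum_mul, hp, one_mul]
  have h0 : ∑ x, p x * ∑ y, p y * (f x y - c) = 0 := by
    simp only [mul_sub, Finset.sum_sub_distrib, ← Finset.sum_mul, hp, one_mul, hc, sub_self]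
  have h1 := iidMean_pairStat_sq hp (f := fun x y => f x y - c) (fun x y => by rw [hf]) h0 k
  simp only [hg] at h1
  rw [iidMean_congr (G := fun S => pairStat (fun x y => f x y - c) S ^ 2) fun S hS => by
    rw [pairStat_sub_const, hS], h1]
  have hk' : (1 : ℝ) ≤ k := by exact_mod_cast hk
  have h2 : ∑ x, p x * ∑ y, p y * (f x y - c) ^ 2 ≤ ∑ x, p x * ∑ y, p y * f x y ^ 2 := by
    have := sum_mul_sub_mean_sq_le (p := fun z : α × α => p z.1 * p z.2)
      (by simp only [Fintype.sum_prod_type, ← Finset.mul_sum, hp, mul_one])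
      (fun z => f z.1 z.2)
    simpa only [Fintype.sum_prod_type, mul_assoc, ← Finset.mul_sum, hc] using this
  have h3 : (0 : ℝ) ≤ 2 * k * (k - 1) := mul_nonneg (by positivity) (by linarith)
  gcongr

end UStatistic

/-! ### The truncated `χ²` test -/

section Tester

variable {α : Type}

lemma card_of_mem_support_iidSamples (p : PMF α) (k : ℕ) :
    ∀ S ∈ (iidSamples p k).support, S.card = k := by
  induction k with
  | zero => simp [iidSamples]
  | succ k ih =>
    intro S hS
    simp only [iidSamples, PMF.mem_support_bind_iff, PMF.mem_support_map_iff] at hS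
    obtain ⟨x, -, S', hS', rfl⟩ := hS
    simp [ih S' hS']

lemma expect_iidSamples_ofReal [Fintype α] (p : PMF α) (k : ℕ) {F : Multiset α → ℝ}
    (hF : ∀ S, 0 ≤ F S) :
    expect (iidSamples p k) (fun S => ENNReal.ofReal (F S)) =
      ENNReal.ofReal (iidMean (fun x => (p x).toReal) k F) ∧
    0 ≤ iidMean (fun x => (p x).toReal) k F := by
  induction k generalizing F with
  | zero => simp [iidSamples, iidMean, hF]
  | succ k ih =>
    simp only [iidSamples, expect_bind, expect_map, iidMean]
    have h := fun x => ih (F := fun S => F (x ::ₘ S)) fun S => hF _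
    simp only [(h _).1]
    exact ⟨expect_ofReal p fun x => (h x).2,
      Finset.sum_nonneg fun x _ => mul_nonneg ENNReal.toReal_nonneg (h x).2⟩

/-- Chebyshev's inequality for the verdict of a test. -/
lemma bind_apply_le_of_iidMean_sq_le [Fintype α] (p : PMF α) (k : ℕ) (T : Multiset α → PMF Bool)
    (b : Bool) (G : Multiset α → ℝ) {a : ℝ} (ha : 0 < a)
    (hG : iidMean (fun x => (p x).toReal) k (fun S => G S ^ 2) ≤ 1 / 5 * a ^ 2)
    (hT : ∀ S : Multiset α, S.card = k → T S b ≠ 0 → a ≤ |G S|) :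
    ((iidSamples p k).bind T) b ≤ ENNReal.ofReal (1 / 5) := by
  rw [bind_apply_eq_expect]
  calc _ ≤ expect (iidSamples p k) (fun S => ENNReal.ofReal ((a ^ 2)⁻¹ * G S ^ 2)) := by
        refine expect_mono_of_support _ fun S hS => ?_
        by_cases h : T S b = 0
        · rw [h]
          exact zero_le
        · refine ((T S).coe_le_one b).trans ?_
          rw [ENNReal.one_le_ofReal, ← div_eq_inv_mul, one_le_div (by positivity), ← sq_abs (G S)]
          exact pow_le_pow_left₀ ha.le (hT S (card_of_mem_support_iidSamples p k S hS) h) 2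
    _ = ENNReal.ofReal ((a ^ 2)⁻¹ * iidMean (fun x => (p x).toReal) k (fun S => G S ^ 2)) := by
        rw [(expect_iidSamples_ofReal p k fun S => by positivity).1, iidMean_const_mul]
    _ ≤ _ := by
        refine ENNReal.ofReal_le_ofReal ?_
        rw [inv_mul_le_iff₀ (by positivity)]
        linarith

open Classical in
/-- The kernel `∑ i, (1[x = i] - q i) * (1[y = i] - q i) / (q i + τ)`, expanded. The shift `τ` of the
denominators of the `χ²` statistic bounds the influence of elements of small probability. -/
def chiKernel {α : Type} (q : α → ℝ) (τ : ℝ) (x y : α) : ℝ :=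
  (if x = y then 1 / (q x + τ) else 0) - q x / (q x + τ) - q y / (q y + τ) +
    ∑' i, q i ^ 2 / (q i + τ)

open Classical in
/-- The tester that rejects when the mean of `chiKernel` over all pairs of samples exceeds
`ε / 4`. -/
def chiTester : IdentityTester := fun α ε q S =>
  PMF.pure (decide (pairStat (chiKernel (fun x => (q x).toReal) (ε / Nat.card α)) S ≤
    S.card * (S.card - 1) * (ε / 4)))

lemma chiKernel_symm (q : α → ℝ) (τ : ℝ) (x y : α) : chiKernel q τ x y = chiKernel q τ y x := by
  unfold chiKernel
  rcases eq_or_ne x y with rfl | h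
  · rfl
  · rw [if_neg h, if_neg h.symm]
    ring

section Moments

variable [Fintype α] {p q : α → ℝ} {τ : ℝ}

lemma sum_mul_chiKernel (hp : ∑ x, p x = 1) (x : α) :
    ∑ y, p y * chiKernel q τ x y =
      (p x - q x) / (q x + τ) - ∑ i, q i * ((p i - q i) / (q i + τ)) := by
  classical
  simp only [chiKernel, mul_add, mul_sub, Finset.sum_add_distrib, Finset.sum_sub_distrib,
    ← Finset.sum_mul, hp, tsum_fintype, mul_ite, mul_zero, Finset.sum_ite_eq, Finset.mem_univ,
    if_true, one_mul]
  have : ∑ i, q i * ((p i - q i) / (q i + τ)) =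
      ∑ i, p i * (q i / (q i + τ)) - ∑ i, q i ^ 2 / (q i + τ) := by
    rw [← Finset.sum_sub_distrib]
    exact Finset.sum_congr rfl fun i _ => by ring
  rw [this]
  ring

/-- The mean of the kernel is the shifted `χ²` distance. -/
lemma sum_sum_mul_chiKernel (hp : ∑ x, p x = 1) :
    ∑ x, p x * ∑ y, p y * chiKernel q τ x y = ∑ i, (p i - q i) ^ 2 / (q i + τ) := by
  simp only [sum_mul_chiKernel hp, mul_sub, Finset.sum_sub_distrib, ← Finset.sum_mul, hp, one_mul]
  rw [← Finset.sum_sub_distrib]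
  exact Finset.sum_congr rfl fun i _ => by ring

lemma sum_mul_projection_sq_le (hp : ∑ x, p x = 1) :
    ∑ x, p x * ((∑ y, p y * chiKernel q τ x y) - ∑ i, (p i - q i) ^ 2 / (q i + τ)) ^ 2 ≤
      ∑ x, p x * ((p x - q x) / (q x + τ)) ^ 2 := by
  refine le_trans (le_of_eq (Finset.sum_congr rfl fun x _ => ?_))
    (sum_mul_sub_mean_sq_le hp fun x => (p x - q x) / (q x + τ))
  have : ∑ y, p y * ((p y - q y) / (q y + τ)) = ∑ i, q i * ((p i - q i) / (q i + τ)) +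
      ∑ i, (p i - q i) ^ 2 / (q i + τ) := by
    rw [← Finset.sum_add_distrib]
    exact Finset.sum_congr rfl fun i _ => by ring
  rw [sum_mul_chiKernel hp, this]
  ring

lemma sum_sum_mul_chiKernel_sq_le (hp0 : ∀ x, 0 ≤ p x) (hp : ∑ x, p x = 1)
    (hq0 : ∀ x, 0 ≤ q x) (hq : ∑ x, q x = 1) (hτ : 0 < τ) :
    ∑ x, p x * ∑ y, p y * chiKernel q τ x y ^ 2 ≤ 4 * (∑ i, (p i / (q i + τ)) ^ 2 + 3) := by
  classical
  have hw : ∀ x, 0 < q x + τ := fun x => by linarith [hq0 x]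
  have hr0 : ∀ x, 0 ≤ q x / (q x + τ) := fun x => div_nonneg (hq0 x) (hw x).le
  have hr1 : ∀ x, q x / (q x + τ) ≤ 1 := fun x => (div_le_one (hw x)).2 (by linarith)
  set c := ∑ i, q i ^ 2 / (q i + τ) with hc
  have hc0 : 0 ≤ c := Finset.sum_nonneg fun i _ => div_nonneg (sq_nonneg _) (hw i).le
  have hc1 : c ≤ 1 := by
    rw [← hq]
    refine Finset.sum_le_sum fun i _ => ?_
    calc q i ^ 2 / (q i + τ) = q i * (q i / (q i + τ)) := by ring
      _ ≤ q i * 1 := by gcongr; exacts [hq0 i, hr1 i]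
      _ = q i := mul_one _
  have hbound : ∀ x y, chiKernel q τ x y ^ 2 ≤
      4 * ((if x = y then (1 / (q x + τ)) ^ 2 else 0) + 3) := fun x y => by
    have h : chiKernel q τ x y = (if x = y then 1 / (q x + τ) else 0) - q x / (q x + τ) -
        q y / (q y + τ) + c := by
      rw [chiKernel, tsum_fintype]
    have hsq : (if x = y then (1 / (q x + τ)) ^ 2 else 0) =
        (if x = y then 1 / (q x + τ) else 0) ^ 2 := by
      split_ifs <;> simp
    rw [h, hsq]
    have h1 := pow_le_one₀ (n := 2) (hr0 x) (hr1 x)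
    have h2 := pow_le_one₀ (n := 2) (hr0 y) (hr1 y)
    have h3 := pow_le_one₀ (n := 2) hc0 hc1
    generalize (if x = y then 1 / (q x + τ) else 0) = u
    generalize q x / (q x + τ) = v at *
    generalize q y / (q y + τ) = w at *
    -- `(u - v - w + c) ^ 2 ≤ 4 * (u ^ 2 + v ^ 2 + w ^ 2 + c ^ 2)`
    nlinarith [sq_nonneg (u + v), sq_nonneg (u + w), sq_nonneg (u - c), sq_nonneg (v - w),
      sq_nonneg (v + c), sq_nonneg (w + c)]
  calc ∑ x, p x * ∑ y, p y * chiKernel q τ x y ^ 2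
      ≤ ∑ x, p x * ∑ y, p y * (4 * ((if x = y then (1 / (q x + τ)) ^ 2 else 0) + 3)) := by
        gcongr with x _ y _
        · exact hp0 x
        · exact hp0 y
        · exact hbound x y
    _ = ∑ x, (4 * (p x / (q x + τ)) ^ 2 + p x * 12) := by
        refine Finset.sum_congr rfl fun x _ => ?_
        have : ∀ y, p y * (4 * ((if x = y then (1 / (q x + τ)) ^ 2 else 0) + 3)) =
            (if x = y then 4 * p y * (1 / (q x + τ)) ^ 2 else 0) + p y * 12 := fun y => by
          split_ifs <;> ring
        simp only [this, Finset.sum_add_distrib, ← Finset.sum_mul, hp, Finset.sum_ite_eq,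
          Finset.mem_univ, if_true]
        ring
    _ = _ := by
        rw [Finset.sum_add_distrib, ← Finset.sum_mul, hp, ← Finset.mul_sum]
        ring

/-- The shifted `χ²` distance dominates the Hellinger distance up to the total shift. -/
lemma sq_sqrt_sub_sqrt_le {a b τ : ℝ} (ha : 0 ≤ a) (hb : 0 ≤ b) (hτ : 0 < τ) :
    (√a - √b) ^ 2 ≤ 2 * ((a - b) ^ 2 / (b + τ)) + τ := by
  have hsa := Real.sq_sqrt ha
  have hsb := Real.sq_sqrt hb
  have ha' := Real.sqrt_nonneg a
  have hb' := Real.sqrt_nonneg b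
  have hw : 0 < b + τ := by linarith
  rcases le_total (a + b) τ with h | h
  · have : 0 ≤ (a - b) ^ 2 / (b + τ) := by positivity
    nlinarith [mul_nonneg ha' hb']
  · have h1 : (a - b) ^ 2 = (√a - √b) ^ 2 * (√a + √b) ^ 2 := by
      rw [← mul_pow, ← hsa, ← hsb, Real.sqrt_sq ha', Real.sqrt_sq hb']
      ring
    have h2 : b + τ ≤ 2 * (√a + √b) ^ 2 := by nlinarith [mul_nonneg ha' hb']
    have h3 : (√a - √b) ^ 2 ≤ 2 * ((a - b) ^ 2 / (b + τ)) := by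
      rw [h1, ← mul_div_assoc, le_div_iff₀ hw]
      nlinarith [mul_le_mul_of_nonneg_left h2 (sq_nonneg (√a - √b))]
    linarith

end Moments

lemma sum_div_sq_le [Fintype α] {p q : α → ℝ} {τ : ℝ} (hq0 : ∀ x, 0 ≤ q x) (hτ : 0 < τ) :
    ∑ i, (p i / (q i + τ)) ^ 2 ≤
      2 * Fintype.card α + 2 * ((∑ i, (p i - q i) ^ 2 / (q i + τ)) / τ) := by
  have hw : ∀ x, 0 < q x + τ := fun x => by linarith [hq0 x]
  calc ∑ i, (p i / (q i + τ)) ^ 2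
      ≤ ∑ i, (2 + 2 * ((p i - q i) ^ 2 / (q i + τ) / τ)) := by
        refine Finset.sum_le_sum fun i _ => ?_
        have h1 : p i / (q i + τ) = q i / (q i + τ) + (p i - q i) / (q i + τ) := by ring
        have h2 : (q i / (q i + τ)) ^ 2 ≤ 1 := pow_le_one₀ (div_nonneg (hq0 i) (hw i).le)
          ((div_le_one (hw i)).2 (by linarith))
        have h3 : ((p i - q i) / (q i + τ)) ^ 2 ≤ (p i - q i) ^ 2 / (q i + τ) / τ := by
          rw [div_pow, div_div, sq (q i + τ)]
          have := hw i
          gcongr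
          linarith [hq0 i]
        rw [h1]
        nlinarith [sq_nonneg (q i / (q i + τ) - (p i - q i) / (q i + τ))]
    _ = _ := by
        rw [Finset.sum_add_distrib, ← Finset.mul_sum, Finset.sum_div]
        simp
        ring

lemma sum_mul_div_sq_le [Fintype α] {p q : α → ℝ} {τ : ℝ} (hq0 : ∀ x, 0 ≤ q x) (hτ : 0 < τ) :
    ∑ x, p x * ((p x - q x) / (q x + τ)) ^ 2 ≤
      √(∑ i, (p i / (q i + τ)) ^ 2) * ∑ i, (p i - q i) ^ 2 / (q i + τ) := by
  rw [Finset.mul_sum]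
  refine Finset.sum_le_sum fun x _ => ?_
  have h1 : p x / (q x + τ) ≤ √(∑ i, (p i / (q i + τ)) ^ 2) := Real.le_sqrt_of_sq_le
    (Finset.single_le_sum (f := fun i => (p i / (q i + τ)) ^ 2) (fun i _ => sq_nonneg _)
      (Finset.mem_univ x))
  have h2 : 0 ≤ (p x - q x) ^ 2 / (q x + τ) :=
    div_nonneg (sq_nonneg _) (by linarith [hq0 x])
  calc _ = p x / (q x + τ) * ((p x - q x) ^ 2 / (q x + τ)) := by ring
    _ ≤ _ := mul_le_mul_of_nonneg_right h1 h2

lemma iidMean_chiKernel_sq_le [Fintype α] {p q : α → ℝ} {τ : ℝ} (hp0 : ∀ x, 0 ≤ p x)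
    (hp : ∑ x, p x = 1) (hq0 : ∀ x, 0 ≤ q x) (hq : ∑ x, q x = 1) (hτ : 0 < τ) {k : ℕ}
    (hk : 2 ≤ k) :
    iidMean p k (fun S => (pairStat (chiKernel q τ) S -
        k * (k - 1) * ∑ i, (p i - q i) ^ 2 / (q i + τ)) ^ 2) ≤
      k * (k - 1) * (8 * (∑ i, (p i / (q i + τ)) ^ 2 + 3) +
        4 * k * ∑ x, p x * ((p x - q x) / (q x + τ)) ^ 2) := by
  have hk' : (2 : ℝ) ≤ k := by exact_mod_cast hk
  refine (iidMean_pairStat_sub_sq_le hp (chiKernel_symm q τ) (sum_sum_mul_chiKernel hp) k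
    (by omega)).trans ?_
  have hF := sum_sum_mul_chiKernel_sq_le hp0 hp hq0 hq hτ
  have hv := sum_mul_projection_sq_le (q := q) (τ := τ) hp
  have hv0 : 0 ≤ ∑ x, p x * ((p x - q x) / (q x + τ)) ^ 2 :=
    Finset.sum_nonneg fun x _ => mul_nonneg (hp0 x) (sq_nonneg _)
  have hkk : (0 : ℝ) ≤ k * (k - 1) := mul_nonneg (by linarith) (by linarith)
  have h1 := mul_le_mul_of_nonneg_left hF hkk
  have h2 := mul_le_mul_of_nonneg_left hv (mul_nonneg hkk (show (0 : ℝ) ≤ k - 2 by linarith))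
  have h3 := mul_nonneg hkk hv0
  linarith

/-- The sample size is so large that the number of pairs dominates the variance of the statistic
under the null hypothesis. -/
lemma iidMean_chiKernel_sq_le_of_eq [Fintype α] [Nonempty α] {q : α → ℝ} {ε : ℝ} (hε : 0 < ε)
    (hq0 : ∀ x, 0 ≤ q x) (hq : ∑ x, q x = 1) {k : ℕ} (hk : (2000 : ℝ) ≤ k)
    (hkε : 4000000 * (Fintype.card α : ℝ) ≤ (k * ε) ^ 2) :
    iidMean q k (fun S => pairStat (chiKernel q (ε / Fintype.card α)) S ^ 2) ≤
      1 / 5 * (k * (k - 1) * (ε / 4)) ^ 2 := by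
  have hN : (1 : ℝ) ≤ Fintype.card α := by exact_mod_cast Fintype.card_pos
  have hτ : 0 < ε / Fintype.card α := by positivity
  have h := iidMean_chiKernel_sq_le hq0 hq hq0 hq hτ (k := k) (by
    have : (2 : ℝ) ≤ k := by linarith
    exact_mod_cast this)
  have hB := sum_div_sq_le (p := q) hq0 hτ
  simp only [sub_self, zero_pow two_ne_zero, zero_div, Finset.sum_const_zero, mul_zero, sub_zero,
    add_zero] at h hB
  refine h.trans ?_
  set B := ∑ i, (q i / (q i + ε / Fintype.card α)) ^ 2
  generalize (Fintype.card α : ℝ) = N at *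
  have hkk : (k : ℝ) ^ 2 / 2 ≤ k * (k - 1) := by nlinarith
  have hkk0 : (0 : ℝ) ≤ k * (k - 1) := mul_nonneg (by linarith) (by linarith)
  have h3 : 8 * (B + 3) ≤ 1 / 80 * (k * (k - 1)) * ε ^ 2 := by
    have := mul_le_mul_of_nonneg_right hkk (sq_nonneg ε)
    linarith [mul_pow (k : ℝ) ε 2]
  have h4 := mul_le_mul_of_nonneg_left h3 hkk0
  linarith

/-- When the shifted `χ²` distance is at least `ε / 2`, the fluctuations of the statistic are small
compared to its mean. -/
lemma iidMean_chiKernel_sq_le_of_le [Fintype α] [Nonempty α] {p q : α → ℝ} {ε : ℝ} (hε : 0 < ε)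
    (hp0 : ∀ x, 0 ≤ p x) (hp : ∑ x, p x = 1)
    (hq0 : ∀ x, 0 ≤ q x) (hq : ∑ x, q x = 1) {k : ℕ} (hk : (2000 : ℝ) ≤ k)
    (hkε : 4000000 * (Fintype.card α : ℝ) ≤ (k * ε) ^ 2)
    {χ : ℝ} (hχ : ∑ i, (p i - q i) ^ 2 / (q i + ε / Fintype.card α) = χ) (hχε : ε / 2 ≤ χ) :
    iidMean p k (fun S => (pairStat (chiKernel q (ε / Fintype.card α)) S - k * (k - 1) * χ) ^ 2) ≤
      1 / 5 * (k * (k - 1) * (χ / 2)) ^ 2 := by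
  have hN : (1 : ℝ) ≤ Fintype.card α := by exact_mod_cast Fintype.card_pos
  have hτ : 0 < ε / Fintype.card α := by positivity
  have h := iidMean_chiKernel_sq_le hp0 hp hq0 hq hτ (k := k) (by
    have : (2 : ℝ) ≤ k := by linarith
    exact_mod_cast this)
  have hB := sum_div_sq_le (p := p) hq0 hτ
  have hv := sum_mul_div_sq_le (p := p) hq0 hτ
  have hB0 : 0 ≤ ∑ i, (p i / (q i + ε / Fintype.card α)) ^ 2 :=
    Finset.sum_nonneg fun i _ => sq_nonneg _
  rw [hχ] at h hB hv
  refine h.trans ?_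
  generalize ∑ i, (p i / (q i + ε / Fintype.card α)) ^ 2 = B at *
  generalize ∑ x, p x * ((p x - q x) / (q x + ε / Fintype.card α)) ^ 2 = v at *
  generalize (Fintype.card α : ℝ) = N at *
  clear h hχ
  have hχ0 : 0 < χ := by linarith
  have hD : χ / (ε / N) = χ * N / ε := by field_simp
  rw [hD] at hB
  have hND : N ≤ 2 * (χ * N / ε) := by
    rw [← mul_div_assoc, le_div_iff₀ hε]
    nlinarith
  have hkD : 2000000 * (χ * N / ε) ≤ (k * χ) ^ 2 := by
    rw [mul_div_assoc', div_le_iff₀ hε]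
    have h1 := mul_le_mul_of_nonneg_right hkε hχ0.le
    have h2 := mul_le_mul_of_nonneg_left hχε (show 0 ≤ (k : ℝ) ^ 2 * χ * ε by positivity)
    linarith [mul_pow (k : ℝ) ε 2]
  have hsB : 320 * √B ≤ k * χ := by
    refine (pow_le_pow_iff_left₀ (by positivity) (by positivity) two_ne_zero).1 ?_
    rw [mul_pow, Real.sq_sqrt hB0]
    linarith
  have hkk : (k : ℝ) ^ 2 / 2 ≤ k * (k - 1) := by nlinarith
  have hkk0 : (0 : ℝ) ≤ k * (k - 1) := mul_nonneg (by linarith) (by linarith)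
  have hkv : 4 * k * v ≤ 1 / 80 * (k * χ) ^ 2 := by
    have h1 := mul_le_mul_of_nonneg_left hv (show (0 : ℝ) ≤ 4 * k by positivity)
    have h2 := mul_le_mul_of_nonneg_right hsB (show (0 : ℝ) ≤ k * χ by positivity)
    linarith
  have h3 : 8 * (B + 3) + 4 * k * v ≤ 1 / 20 * (k * (k - 1)) * χ ^ 2 := by
    have := mul_le_mul_of_nonneg_right hkk (sq_nonneg χ)
    linarith [mul_pow (k : ℝ) χ 2]
  have h4 := mul_le_mul_of_nonneg_left h3 hkk0
  linarith

lemma le_sum_div_of_le_hellingerSq [Fintype α] [Nonempty α] {p q : PMF α} {ε : ℝ} (hε : 0 < ε)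
    (h : ε ≤ hellingerSq p q) :
    ε / 2 ≤ ∑ i, ((p i).toReal - (q i).toReal) ^ 2 / ((q i).toReal + ε / Fintype.card α) := by
  have hN : (0 : ℝ) < Fintype.card α := by exact_mod_cast Fintype.card_pos
  have h1 : ∑ x, (√(p x).toReal - √(q x).toReal) ^ 2 ≤
      2 * ∑ i, ((p i).toReal - (q i).toReal) ^ 2 / ((q i).toReal + ε / Fintype.card α) + ε := by
    calc _ ≤ ∑ i, (2 * (((p i).toReal - (q i).toReal) ^ 2 /
            ((q i).toReal + ε / Fintype.card α)) + ε / Fintype.card α) :=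
          Finset.sum_le_sum fun x _ =>
            sq_sqrt_sub_sqrt_le ENNReal.toReal_nonneg ENNReal.toReal_nonneg (by positivity)
      _ = _ := by
          rw [Finset.sum_add_distrib, ← Finset.mul_sum, Finset.sum_const, nsmul_eq_mul,
            Finset.card_univ, mul_div_cancel₀ _ hN.ne']
  have h2 : ε ≤ 1 / 2 * ∑ x, (√(p x).toReal - √(q x).toReal) ^ 2 := h
  linarith

/-- A verdict of probability at most `1/5` leaves probability `4/5` to the other one. -/
lemma le_apply_not_of_apply_le {p : PMF Bool} {b : Bool} (h : p b ≤ ENNReal.ofReal (1 / 5)) :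
    4 / 5 ≤ p (!b) := by
  have h15 : (4 / 5 : ℝ≥0∞) + ENNReal.ofReal (1 / 5) = 1 := by
    have : (4 / 5 : ℝ≥0∞) = ENNReal.ofReal (4 / 5) := by
      rw [ENNReal.ofReal_div_of_pos (by norm_num)]
      norm_num
    rw [this, ← ENNReal.ofReal_add (by norm_num) (by norm_num), ← ENNReal.ofReal_one]
    norm_num
  refine (ENNReal.add_le_add_iff_right (ENNReal.ofReal_ne_top (r := 1 / 5))).1 ?_
  rw [h15, ← apply_true_add_apply_false p]
  cases b
  · exact add_le_add_right h _
  · rw [add_comm]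
    exact add_le_add_right h _

theorem isHellingerTester_chiTester : chiTester.IsHellingerTester 2000 := by
  classical
  intro α _ ε hε hε1 q k hk p
  have hne : Nonempty α := p.support_nonempty.to_type
  have hN1 : (1 : ℝ) ≤ Fintype.card α := by exact_mod_cast Fintype.card_pos
  have hkε := (div_le_iff₀ hε).1 hk
  have hkε2 : 4000000 * (Fintype.card α : ℝ) ≤ (k * ε) ^ 2 := by
    have := pow_le_pow_left₀ (by positivity) hkε 2
    rw [mul_pow, Real.sq_sqrt (by positivity)] at this
    linarith
  have hk2 : (2000 : ℝ) ≤ k := by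
    have h1 := Real.one_le_sqrt.2 hN1
    have h2 := mul_le_mul_of_nonneg_left hε1 (Nat.cast_nonneg (α := ℝ) k)
    linarith
  have hkk0 : (0 : ℝ) < k * (k - 1) := mul_pos (by linarith) (by linarith)
  have hT : ∀ S, chiTester α ε q S = PMF.pure (decide
      (pairStat (chiKernel (fun x => (q x).toReal) (ε / Fintype.card α)) S ≤
        S.card * (S.card - 1) * (ε / 4))) := by
    intro S
    rw [chiTester, Nat.card_eq_fintype_card]
  constructor
  · rintro rfl
    refine le_apply_not_of_apply_le (b := false) (bind_apply_le_of_iidMean_sq_le p k _ false _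
      (mul_pos hkk0 (by positivity : 0 < ε / 4))
      (iidMean_chiKernel_sq_le_of_eq hε (fun x => ENNReal.toReal_nonneg) (sum_toReal_eq_one p) hk2
        hkε2) fun S hS h => ?_)
    rw [hT, hS] at h
    refine le_trans (le_of_lt ?_) (le_abs_self _)
    by_contra! hle
    simp [hle] at h
  · intro hH
    have hχ := le_sum_div_of_le_hellingerSq hε hH
    refine le_apply_not_of_apply_le (b := true) (bind_apply_le_of_iidMean_sq_le p k _ true _
      (mul_pos hkk0 (by linarith))
      (iidMean_chiKernel_sq_le_of_le hε (fun x => ENNReal.toReal_nonneg) (sum_toReal_eq_one p)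
        (fun x => ENNReal.toReal_nonneg) (sum_toReal_eq_one q) hk2 hkε2 rfl hχ) fun S hS h => ?_)
    rw [hT, hS] at h
    have hle : pairStat (chiKernel (fun x => (q x).toReal) (ε / Fintype.card α)) S ≤
        k * (k - 1) * (ε / 4) := by
      by_contra! hlt
      simp [hlt] at h
    have h2 := mul_le_mul_of_nonneg_left hχ hkk0.le
    rw [abs_sub_comm]
    refine le_trans ?_ (le_abs_self _)
    linarith

end Tester

/-! ### The verdict of the Independent Edges Sampler -/

section Sampler

variable {n : ℕ} [NeZero n]

/-- A Chernoff bound for the multiplicity of a state in a uniform sample. -/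
lemma expect_le_count_le (k x : ℕ) (i : Fin n) :
    expect (iidSamples (PMF.uniformOfFintype (Fin n)) k)
      (fun h => if x ≤ h.count i then 1 else 0) ≤ ENNReal.ofReal (Real.exp (2 * k / n - x)) := by
  have hn : (0 : ℝ) < n := Nat.cast_pos.2 (NeZero.pos n)
  set p : Fin n → ℝ := fun j => (PMF.uniformOfFintype (Fin n) j).toReal with hp
  have hM : ∑ j, p j * Real.exp (if i = j then 1 else 0) ≤ Real.exp (2 / n) := by
    have h1 : ∑ j, p j * Real.exp (if i = j then 1 else 0) = 1 + (Real.exp 1 - 1) / n := by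
      calc _ = ∑ j, (p j + if i = j then p j * (Real.exp 1 - 1) else 0) := by
            refine Finset.sum_congr rfl fun j _ => ?_
            split_ifs
            · ring
            · simp
        _ = _ := by
            rw [Finset.sum_add_distrib, sum_toReal_eq_one]
            simp [hp]
            ring
    rw [h1]
    have h2 := Real.add_one_le_exp (2 / n : ℝ)
    have h3 : (Real.exp 1 - 1) / n ≤ 2 / n := by
      gcongr
      linarith [Real.exp_one_lt_d9]
    linarith
  have hmean : ∀ k, iidMean p k (fun h => Real.exp (h.count i)) ≤ Real.exp (2 * k / n) := by
    intro k
    induction k with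
    | zero => simp [iidMean]
    | succ k ih =>
      have h1 : ∀ h : Multiset (Fin n), ∑ j, p j * Real.exp ((j ::ₘ h).count i) =
          (∑ j, p j * Real.exp (if i = j then 1 else 0)) * Real.exp (h.count i) := fun h => by
        rw [Finset.sum_mul]
        refine Finset.sum_congr rfl fun j _ => ?_
        rw [mul_assoc, ← Real.exp_add, Multiset.count_cons]
        push_cast
        rw [add_comm]
      simp only [iidMean_succ, h1, iidMean_const_mul]
      calc _ ≤ Real.exp (2 / n) * Real.exp (2 * k / n) := by
            gcongr
            exact (expect_iidSamples_ofReal (PMF.uniformOfFintype (Fin n)) k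
              fun h => (Real.exp_pos _).le).2
        _ = _ := by
            rw [← Real.exp_add]
            congr 1
            push_cast
            ring
  calc _ ≤ expect (iidSamples (PMF.uniformOfFintype (Fin n)) k)
        (fun h => ENNReal.ofReal (Real.exp (-x) * Real.exp (h.count i))) := by
        refine expect_mono _ fun h => ?_
        split_ifs with hx
        · rw [ENNReal.one_le_ofReal, ← Real.exp_add]
          refine Real.one_le_exp ?_
          have : (x : ℝ) ≤ h.count i := by exact_mod_cast hx
          linarith
        · exact zero_le
    _ ≤ ENNReal.ofReal (Real.exp (-x) * Real.exp (2 * k / n)) := by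
        rw [(expect_iidSamples_ofReal _ k fun h => by positivity).1, iidMean_const_mul]
        gcongr
        exact hmean k
    _ = _ := by
        rw [← Real.exp_add]
        congr 2
        ring

lemma trajectory_bind_sampler_apply (T : IdentityTester) (θ ε : ℝ) (P Q : Chain n)
    (μ : PMF (Fin n)) (t : ℕ) (b : Bool) :
    ((trajectory P μ (t + 1)).bind (independentEdgesSampler T θ ε Q)) b =
      expect μ fun s => expect (steps P t s) fun u =>
        expect (iidSamples (PMF.uniformOfFintype (Fin n))
          ⌊θ * (t + 1 : ℕ) / Real.log (2 * n / ε) ^ 2⌋₊) fun h =>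
          (if ∃ i, (collect (fun i => h.count i) (s :: u) i).card < h.count i then PMF.pure false
            else T (Fin n × Fin n) ε (edgeDist Q)
              (∑ i, collect (fun i => h.count i) (s :: u) i)) b := by
  rw [bind_apply_eq_expect, trajectory, expect_bind]
  congr 1
  funext s
  rw [walk_eq_map_steps, expect_map]
  refine expect_congr_of_support _ fun u hu => ?_
  rw [independentEdgesSampler, bind_apply_eq_expect, List.length_cons,
    length_of_mem_support_steps P t s u hu]

/-- On the event that all states are full, the recorded transitions are no more likely to produce a
verdict than independent samples of the edge distribution. -/
lemma expect_evalIfFull_collect_le (P : Chain n) (μ : PMF (Fin n)) (t k : ℕ)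
    (V : Multiset (Fin n × Fin n) → PMF Bool) (b : Bool) :
    (expect μ fun s => expect (steps P t s) fun u =>
      expect (iidSamples (PMF.uniformOfFintype (Fin n)) k) fun h =>
        evalIfFull (fun i => h.count i) (fun M => V M b)
          (collect (fun i => h.count i) (s :: u))) ≤
      ((iidSamples (edgeDist P) k).bind V) b := by
  rw [← iidSamples_bind_edgeSamples, PMF.bind_bind, bind_apply_eq_expect]
  refine (expect_mono _ fun s => ?_).trans_eq (expect_const μ _)
  rw [expect_comm]
  refine expect_mono _ fun h => ?_
  rw [bind_apply_eq_expect]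
  simpa [collect] using
    expect_collect_le P (fun i => h.count i) (fun M => V M b) t s (fun _ => 0) h fun i => by simp

lemma sampler_apply_true_le (T : IdentityTester) (θ ε : ℝ) (P Q : Chain n) (μ : PMF (Fin n))
    (t : ℕ) :
    ((trajectory P μ (t + 1)).bind (independentEdgesSampler T θ ε Q)) true ≤
      ((iidSamples (edgeDist P) ⌊θ * (t + 1 : ℕ) / Real.log (2 * n / ε) ^ 2⌋₊).bind
        (T (Fin n × Fin n) ε (edgeDist Q))) true := by
  rw [trajectory_bind_sampler_apply]
  refine le_trans (le_of_eq ?_) (expect_evalIfFull_collect_le P μ t _ _ true)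
  simp only [evalIfFull]
  refine congrArg _ (funext fun s => congrArg _ (funext fun u => congrArg _ (funext fun h => ?_)))
  split_ifs <;> simp

/-- The sampler rejects at most as often as the tester does on independent samples, apart from the
event that some state is not full; in that event the state is left too rarely or the histogram has
a large entry. -/
lemma sampler_apply_false_le (T : IdentityTester) (θ ε : ℝ) {P : Chain n} (hP : P.Symmetric)
    (hh : hittingTime P ≠ ⊤) (Q : Chain n) (μ : PMF (Fin n)) (t k K : ℕ)
    (hk : ⌊θ * (t + 1 : ℕ) / Real.log (2 * n / ε) ^ 2⌋₊ = k) :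
    ((trajectory P μ (t + 1)).bind (independentEdgesSampler T θ ε Q)) false ≤
      ((iidSamples (edgeDist P) k).bind (T (Fin n × Fin n) ε (edgeDist Q))) false +
      ENNReal.ofReal (n * (2 * Real.exp (n * K / ((hittingTime P).toReal + 1) -
          t / (2 * ((hittingTime P).toReal + 1))) +
        Real.exp (2 * k / n - (K + 1 : ℕ)))) := by
  rw [trajectory_bind_sampler_apply, hk]
  have hpoint : ∀ (s : Fin n) (u : List (Fin n)) (h : Multiset (Fin n)),
      (if ∃ i, (collect (fun i => h.count i) (s :: u) i).card < h.count i then PMF.pure false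
        else T (Fin n × Fin n) ε (edgeDist Q)
          (∑ i, collect (fun i => h.count i) (s :: u) i)) false ≤
      evalIfFull (fun i => h.count i) (fun M => T (Fin n × Fin n) ε (edgeDist Q) M false)
          (collect (fun i => h.count i) (s :: u)) +
        ∑ i, ((if ((s :: u).zip u).countP (fun e => e.1 = i) < K then 1 else 0) +
          if K + 1 ≤ h.count i then 1 else 0) := by
    intro s u h
    unfold evalIfFull
    split_ifs with hfull
    · obtain ⟨i, hi⟩ := hfull
      have h1 := countP_le_card_foldl_addEdge (fun i => h.count i) ((s :: u).zip u) (fun _ => 0) i hi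
      have h2 : ((s :: u).zip u).countP (fun e => e.1 = i) < h.count i :=
        lt_of_le_of_lt ((Nat.le_add_right _ _).trans h1) hi
      rw [zero_add]
      refine le_trans ?_ (Finset.single_le_sum (fun _ _ => zero_le) (Finset.mem_univ i))
      rcases lt_or_ge (((s :: u).zip u).countP (fun e => e.1 = i)) K with h3 | h3
      · simp [h3]
      · have : K + 1 ≤ h.count i := by omega
        simp [this]
    · exact le_self_add
  refine (expect_mono _ fun s => expect_mono _ fun u => expect_mono _ fun h =>
    hpoint s u h).trans ?_
  simp only [expect_add, expect_finset_sum, expect_const]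
  gcongr
  · exact expect_evalIfFull_collect_le P μ t k _ false
  · calc _ ≤ ∑ _i : Fin n, (ENNReal.ofReal (2 * Real.exp (n * K / ((hittingTime P).toReal + 1) -
          t / (2 * ((hittingTime P).toReal + 1)))) +
            ENNReal.ofReal (Real.exp (2 * k / n - (K + 1 : ℕ)))) := by
          refine Finset.sum_le_sum fun i _ => add_le_add ?_ ?_
          · refine (expect_mono _ fun s => ?_).trans_eq (expect_const μ _)
            exact expect_departures_lt_le hP hh i s t K
          · exact expect_le_count_le k (K + 1) i
      _ = _ := by
          rw [Finset.sum_const, Finset.card_univ, Fintype.card_fin, nsmul_eq_mul,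
            ← ENNReal.ofReal_add (by positivity) (by positivity), ← ENNReal.ofReal_natCast,
            ← ENNReal.ofReal_mul (by positivity)]

end Sampler

/-! ### The length of the trajectory -/

section Length

/-- `1 ≤ n / ε` absorbs the negative values of `h * log h`. -/
lemma length_bounds {h ν : ℝ} (hh : 0 ≤ h) (hν : 1 ≤ ν) :
    ν / 2 ≤ h * Real.log h + ν ∧ (h + 1) / 4 ≤ h * Real.log h + ν := by
  rcases hh.eq_or_lt with rfl | hpos
  · simp only [zero_mul, zero_add]
    constructor <;> linarith
  · -- `log y ≥ 1 - 1 / y` at `y = h` gives `h * log h ≥ h - 1`, and at `y = 2 * h` it gives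
    -- `h * log h ≥ -1 / 2`.
    have key : ∀ c : ℝ, 0 < c → c * h - 1 ≤ c * h * (Real.log c + Real.log h) := fun c hc => by
      have h1 := Real.one_sub_inv_le_log_of_pos (mul_pos hc hpos)
      have h2 := mul_le_mul_of_nonneg_left h1 (mul_pos hc hpos).le
      rw [mul_sub, mul_inv_cancel₀ (mul_pos hc hpos).ne', mul_one,
        Real.log_mul hc.ne' hpos.ne'] at h2
      exact h2
    have h1 := key 1 one_pos
    have h2 := key 2 two_pos
    rw [Real.log_one] at h1
    have h3 : h * Real.log 2 ≤ h * 1 := by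
      gcongr
      linarith [Real.log_two_lt_d9]
    constructor <;> linarith

variable {n t : ℕ} {C₀ C ε h : ℝ}

/-- With `θ = 1/100`, the number of samples suffices for the tester, and the bound on the
probability that some state is not full is at most `1/10`. A state counts as left too rarely below
`⌊t / (4 n)⌋` departures. -/
lemma sample_size_bounds (hn : 1 ≤ n) (hC₀ : 0 < C₀) (hC : 200 * (C₀ + 1) + 1000 ≤ C) (hε : 0 < ε)
    (hε1 : ε ≤ 1) (hh : 0 ≤ h)
    (hm : C * Real.log (2 * n / ε) ^ 2 * (h * Real.log h + n / ε) ≤ (t + 1 : ℕ)) :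
    C₀ * n / ε ≤ ⌊1 / 100 * ((t + 1 : ℕ) : ℝ) / Real.log (2 * n / ε) ^ 2⌋₊ ∧
    n * (2 * Real.exp (n * ⌊(t : ℝ) / (4 * n)⌋₊ / (h + 1) - t / (2 * (h + 1))) +
        Real.exp (2 * ⌊1 / 100 * ((t + 1 : ℕ) : ℝ) / Real.log (2 * n / ε) ^ 2⌋₊ / n -
          (⌊(t : ℝ) / (4 * n)⌋₊ + 1 : ℕ))) ≤ 1 / 10 := by
  have hn1 : (1 : ℝ) ≤ n := by exact_mod_cast hn
  have hν : 1 ≤ n / ε := by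
    rw [one_le_div hε]
    linarith
  have hnν : (n : ℝ) ≤ n / ε := by
    rw [le_div_iff₀ hε]
    nlinarith
  obtain ⟨hS1, hS2⟩ := length_bounds hh hν
  set S := h * Real.log h + n / ε
  set L := Real.log (2 * n / ε) with hL
  have hexpL : Real.exp L = 2 * n / ε := Real.exp_log (by positivity)
  have hL2 : Real.log 2 ≤ L := by
    refine Real.log_le_log two_pos ?_
    rw [mul_div_assoc]
    linarith
  have hL1 : 0.69 ≤ L := by linarith [Real.log_two_gt_d9]
  have hL0 : 0 < L := by linarith
  have hLsq : 0.69 * L ≤ L ^ 2 := by nlinarith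
  have hLsq' : 0.47 ≤ L ^ 2 := by nlinarith
  set m : ℝ := ((t + 1 : ℕ) : ℝ) with hm'
  have hC0 : 1000 ≤ C := by linarith
  have hm0 : 0 < m := by positivity
  -- `m / n` and `m / (h + 1)` both exceed a large multiple of `L`.
  have hmn : 250 * L * n ≤ m := by
    have h1 : 1000 * (0.69 * L) * (n / 2) ≤ C * L ^ 2 * S := by
      gcongr
      linarith
    nlinarith
  have hmh : 150 * L * (h + 1) ≤ m := by
    have h1 : 1000 * (0.69 * L) * ((h + 1) / 4) ≤ C * L ^ 2 * S := by
      gcongr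
    nlinarith
  have hmt : m / 2 ≤ t := by
    have h1 : (t : ℝ) + 1 = m := by simp [hm']
    have h2 : 2 ≤ m := by nlinarith
    linarith
  clear_value S L m
  -- `e^{-6 L} = (ε / (2 n)) ^ 6` is small enough for a union bound over the `n` states.
  have hexp : Real.exp (-(6 * L)) ≤ 1 / (64 * n) := by
    have h1 : 2 * (n : ℝ) ≤ Real.exp L := by
      rw [hexpL, mul_div_assoc]
      linarith
    have h2 : 64 * (n : ℝ) ≤ Real.exp L ^ 6 := by
      have h3 : (2 : ℝ) ^ 5 ≤ Real.exp L ^ 5 := by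
        gcongr
        linarith
      calc 64 * (n : ℝ) = 2 ^ 5 * (2 * n) := by ring
        _ ≤ Real.exp L ^ 5 * Real.exp L := by gcongr
        _ = Real.exp L ^ 6 := by ring
    rw [Real.exp_neg, ← one_div, show 6 * L = ((6 : ℕ) : ℝ) * L by norm_num, Real.exp_nat_mul]
    gcongr
  have hfloor : (⌊1 / 100 * m / L ^ 2⌋₊ : ℝ) ≤ 1 / 100 * m / L ^ 2 := Nat.floor_le (by positivity)
  have hfloor' := Nat.lt_floor_add_one (1 / 100 * m / L ^ 2)
  have hK : (⌊(t : ℝ) / (4 * n)⌋₊ : ℝ) ≤ t / (4 * n) := Nat.floor_le (by positivity)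
  have hK' := Nat.lt_floor_add_one ((t : ℝ) / (4 * n))
  constructor
  · have h1 : C * S ≤ m / L ^ 2 := by
      rw [le_div_iff₀ (by positivity)]
      linarith
    have h2 : (200 * (C₀ + 1)) * (n / ε / 2) ≤ C * S := by
      gcongr
      linarith
    have h3 : C₀ * n / ε = C₀ * (n / ε) := mul_div_assoc _ _ _
    have h4 : 1 / 100 * m / L ^ 2 = 1 / 100 * (m / L ^ 2) := mul_div_assoc _ _ _
    rw [h3]
    linarith
  · have he1 : n * ⌊(t : ℝ) / (4 * n)⌋₊ / (h + 1) - t / (2 * (h + 1)) ≤ -(6 * L) := by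
      have h1 : n * (⌊(t : ℝ) / (4 * n)⌋₊ : ℝ) ≤ t / 4 := by
        calc _ ≤ (n : ℝ) * ((t : ℝ) / (4 * n)) := by gcongr
          _ = t / 4 := by
            rw [mul_div_assoc', mul_comm (4 : ℝ), mul_div_mul_left _ _ (by positivity)]
      have h2 : (t : ℝ) / (2 * (h + 1)) = t / 2 / (h + 1) := by rw [div_div]
      rw [h2, ← sub_div, div_le_iff₀ (by positivity)]
      have h3 : 0 ≤ L * (h + 1) := by positivity
      linarith
    have he2 : 2 * (⌊1 / 100 * m / L ^ 2⌋₊ : ℝ) / n - (⌊(t : ℝ) / (4 * n)⌋₊ + 1 : ℕ) ≤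
        -(6 * L) := by
      have h1 : 1 / 100 * m / L ^ 2 ≤ m * 0.0215 := by
        rw [div_le_iff₀ (by positivity)]
        nlinarith
      have h2 : 2 * (⌊1 / 100 * m / L ^ 2⌋₊ : ℝ) / n ≤ 0.043 * m / n :=
        div_le_div_of_nonneg_right (by linarith) (by linarith)
      have h3 : (t : ℝ) / (4 * n) = t / 4 / n := by rw [div_div]
      have h4 : 0.043 * m / n - t / 4 / n ≤ -(6 * L) := by
        rw [← sub_div, div_le_iff₀ (by positivity)]
        have h5 : 0 ≤ L * n := by positivity
        linarith
      push_cast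
      linarith
    have h1 := (Real.exp_le_exp.2 he1).trans hexp
    have h2 := (Real.exp_le_exp.2 he2).trans hexp
    calc _ ≤ (n : ℝ) * (2 * (1 / (64 * n)) + 1 / (64 * n)) := by gcongr
      _ = (3 / 64 : ℝ) := by field_simp; norm_num
      _ ≤ 1 / 10 := by norm_num

end Length

end

end MarkovTesting

open MarkovTesting
theorem theorem4p4 :
    (∃ (T : IdentityTester) (C₀ : ℝ), 0 < C₀ ∧ T.IsHellingerTester C₀) ∧
    ∀ C₀ : ℝ, 0 < C₀ → ∃ (θ C : ℝ) (c : ℕ), 0 < θ ∧ 0 < C ∧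
      ∀ T : IdentityTester, T.IsHellingerTester C₀ →
      ∀ (n : ℕ) [NeZero n] (ε : ℝ), 0 < ε → ε ≤ 1 →
      ∀ Q : Chain n, Q.Symmetric → hittingTime Q ≠ ⊤ →
      ∀ m : ℕ,
        C * Real.log (2 * n / ε) ^ c *
          ((hittingTime Q).toReal * Real.log (hittingTime Q).toReal + n / ε) ≤ m →
      ∀ P : Chain n, P.Symmetric → ∀ μ : PMF (Fin n),
        (P = Q →
          2 / 3 ≤ ((trajectory P μ m).bind (independentEdgesSampler T θ ε Q)) true) ∧
        (ε < 1 - specRadius (sqrtProd P Q) →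
          2 / 3 ≤ ((trajectory P μ m).bind (independentEdgesSampler T θ ε Q)) false) := by
  refine ⟨⟨chiTester, 2000, by norm_num, isHellingerTester_chiTester⟩, fun C₀ hC₀ =>
    ⟨1 / 100, 200 * (C₀ + 1) + 1000, 2, by norm_num, by positivity, ?_⟩⟩
  intro T hT n _ ε hε hε1 Q hQ hh m hm P hP μ
  have hn : 1 ≤ n := NeZero.one_le
  have hn1 : (1 : ℝ) ≤ n := by exact_mod_cast hn
  have hν : 1 ≤ n / ε := by
    rw [one_le_div hε]
    linarith
  -- The lower bound on `m` is positive, so the trajectory has a first state.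
  obtain ⟨t, rfl⟩ : ∃ t, m = t + 1 := by
    refine Nat.exists_eq_succ_of_ne_zero ?_
    rintro rfl
    have hS := (length_bounds (ENNReal.toReal_nonneg (a := hittingTime Q)) hν).1
    have hL : 0 < Real.log (2 * n / ε) := Real.log_pos (by rw [mul_div_assoc]; linarith)
    have := mul_pos (mul_pos (show 0 < 200 * (C₀ + 1) + 1000 by positivity) (pow_pos hL 2))
      (lt_of_lt_of_le (by positivity) hS)
    rw [Nat.cast_zero] at hm
    linarith
  obtain ⟨hk, hfail⟩ := sample_size_bounds hn hC₀ le_rfl hε hε1 ENNReal.toReal_nonneg hm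
  have hcard : √(Fintype.card (Fin n × Fin n)) = n := by
    rw [Fintype.card_prod, Fintype.card_fin, Nat.cast_mul, Real.sqrt_mul_self (by positivity)]
  have htest := hT (Fin n × Fin n) ε hε hε1 (edgeDist Q) _ (by rw [hcard]; exact hk) (edgeDist P)
  have h45 : (4 / 5 : ℝ≥0∞) = ENNReal.ofReal (4 / 5) := by
    rw [ENNReal.ofReal_div_of_pos (by norm_num)]
    norm_num
  have h23 : (2 / 3 : ℝ≥0∞) = ENNReal.ofReal (2 / 3) := by
    rw [ENNReal.ofReal_div_of_pos (by norm_num)]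
    norm_num
  -- Passing to the complementary verdict.
  have hcompl : ∀ (p : PMF Bool) (b : Bool) (x : ℝ), 0 ≤ x → x ≤ 1 → ENNReal.ofReal x ≤ p (!b) →
      p b ≤ ENNReal.ofReal (1 - x) := fun p b x hx0 hx1 hx => by
    rw [ENNReal.ofReal_sub _ hx0, ENNReal.ofReal_one]
    refine (ENNReal.le_sub_of_add_le_right ENNReal.ofReal_ne_top ?_)
    rw [← apply_true_add_apply_false p]
    cases b
    · rw [add_comm]
      exact add_le_add_left hx _
    · exact add_le_add_right hx _
  have hcompl' : ∀ (p : PMF Bool) (b : Bool), p (!b) ≤ ENNReal.ofReal (1 / 3) → 2 / 3 ≤ p b :=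
    fun p b h => by
    rw [h23, show (2 / 3 : ℝ) = 1 - 1 / 3 by norm_num, ENNReal.ofReal_sub _ (by norm_num),
      ENNReal.ofReal_one, tsub_le_iff_right, ← apply_true_add_apply_false p]
    cases b
    · rw [add_comm]
      exact add_le_add_right h _
    · exact add_le_add_right h _
  rw [h45] at htest
  constructor
  · rintro rfl
    refine hcompl' _ true ((sampler_apply_false_le T _ ε hP hh P μ t _ ⌊(t : ℝ) / (4 * n)⌋₊
      rfl).trans ?_)
    refine (add_le_add (hcompl _ false (4 / 5) (by norm_num) (by norm_num) (htest.1 rfl))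
      (ENNReal.ofReal_le_ofReal hfail)).trans ?_
    rw [← ENNReal.ofReal_add (by norm_num) (by norm_num)]
    exact ENNReal.ofReal_le_ofReal (by norm_num)
  · intro hρ
    have hfar := hρ.le.trans (one_sub_specRadius_le_hellingerSq hP hQ)
    refine hcompl' _ false ((sampler_apply_true_le T _ ε P Q μ t).trans
      ((hcompl _ true (4 / 5) (by norm_num) (by norm_num) (htest.2 hfar)).trans ?_))
    exact ENNReal.ofReal_le_ofReal (by norm_num)
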